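/- \textbf{Theorem (Minimality).} Terms are $t ::= x \mid \lambda x.t \mid t\,t \mid t[x\backslash u]$, taken up to renaming of bound variables ($x$ is bound in $t$, not in $u$, in $t[x\backslash u]$); values are the abstractions. Below $\varphi,\omega$ are sets of variables, $\mu\in\{\top,\bot\}$ is a flag, and bound variables are always fresh: in a rule that mentions a binder of $x$ (or of $y$), that variable does not belong to $\varphi,\omega$, does not occur in $\rho$, and is not free in the parts of the term outside its scope. \emph{Structures} $S_\varphi$: $x\in S_\varphi$ if $x\in\varphi$; $t\,u\in S_\varphi$ if $t\in S_\varphi$; $t[x\backslash u]\in S_\varphi$ if $t\in S_\varphi$, or if $t\in S_{\varphi\cup\{x\}}$ and $u\in S_\varphi$. \emph{Normal forms} $N_\varphi$: $x\in N_\varphi$ if $x\in\varphi$; $t\,u\in N_\varphi$ if $t\in N_\varphi\cap S_\varphi$ and $u\in N_\varphi$; $\lambda x.t\in N_\varphi$ if $t\in N_{\varphi\cup\{x\}}$; $t[x\backslash u]\in N_\varphi$ if $t\in N_\varphi$, or if $t\in N_{\varphi\cup\{x\}}$ and $u\in N_\varphi\cap S_\varphi$. \emph{Local normal forms} $L_{\varphi,\omega,\mu}$: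 $x\in L_{\varphi,\omega,\mu}$ if $x\in\varphi\cup\omega$; $\lambda x.t\in L_{\varphi,\omega,\top}$ if $t\in L_{\varphi\cup\{x\},\omega,\top}$; $\lambda x.t\in L_{\varphi,\omega,\bot}$ if $t\in L_{\varphi,\omega\cup\{x\},\bot}$; $t\,u\in L_{\varphi,\omega,\mu}$ if $t\in L_{\varphi,\omega,\mu}$ and either ($t\in S_\varphi$ and $u\in L_{\varphi,\omega,\top}$) or $t\in S_\omega$; $t[x\backslash u]\in L_{\varphi,\omega,\mu}$ if $t\in L_{\varphi,\omega,\mu}$, or if $t\in L_{\varphi\cup\{x\},\omega,\mu}$ and $u\in L_{\varphi,\omega,\bot}\cap S_\varphi$, or if $t\in L_{\varphi,\omega\cup\{x\},\mu}$ and $u\in S_\omega$. \emph{Reduction.} For $\rho\in\{\mathsf{dB},\mathsf{lsv}\}\cup\{\mathsf{id}_x\}\cup\{\mathsf{sub}_{x\backslash v}\}$, the relation $t\xrightarrow{\rho,\varphi,\mu}t'$ of $\lambda_{\mathsf{sn}}$ is generated, together with auxiliary relations $\to_{\mathsf{dB}}$ and $\to_{\mathsf{lsv},\varphi,\mu}$,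 by: \begin{itemize} \item $t\,u\xrightarrow{\rho,\varphi,\mu}t'\,u$ if $t\xrightarrow{\rho,\varphi,\bot}t'$; and $t\,u\xrightarrow{\rho,\varphi,\mu}t\,u'$ if $t\in S_\varphi$ and $u\xrightarrow{\rho,\varphi,\top}u'$; \item $\lambda x.t\xrightarrow{\rho,\varphi,\top}\lambda x.t'$ if $t\xrightarrow{\rho,\varphi\cup\{x\},\top}t'$; and $\lambda x.t\xrightarrow{\rho,\varphi,\bot}\lambda x.t'$ if $t\xrightarrow{\rho,\varphi,\bot}t'$; \item $t[x\backslash u]\xrightarrow{\rho,\varphi,\mu}t'[x\backslash u]$ if $t\xrightarrow{\rho,\varphi,\mu}t'$, or if $t\xrightarrow{\rho,\varphi\cup\{x\},\mu}t'$ and $u\in S_\varphi$; \item $t[x\backslash u]\xrightarrow{\rho,\varphi,\mu}t[x\backslash u']$ if $t\xrightarrow{\mathsf{id}_x,\varphi,\mu}t$ and $u\xrightarrow{\rho,\varphi,\bot}u'$; \item $x\xrightarrow{\mathsf{id}_x,\varphi,\mu}x$; $x\xrightarrow{\mathsf{sub}_{x\backslash v},\varphi,\mu}v$; $t\xrightarrow{\mathsf{dB},\varphi,\mu}t'$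 if $t\to_{\mathsf{dB}}t'$; $t\xrightarrow{\mathsf{lsv},\varphi,\mu}t'$ if $t\to_{\mathsf{lsv},\varphi,\mu}t'$; \item $(\lambda x.t)\,u\to_{\mathsf{dB}}t[x\backslash u]$; and $t[x\backslash w]\,u\to_{\mathsf{dB}}s[x\backslash w]$ if $t\,u\to_{\mathsf{dB}}s$; \item (lsv-base) $t[x\backslash v]\to_{\mathsf{lsv},\varphi,\mu}t'[x\backslash v]$ if $t\xrightarrow{\mathsf{sub}_{x\backslash v},\varphi,\mu}t'$ and $v$ is a value; \item $t[x\backslash u[y\backslash w]]\to_{\mathsf{lsv},\varphi,\mu}t'[y\backslash w]$ if $t[x\backslash u]\to_{\mathsf{lsv},\varphi,\mu}t'$, or if $t[x\backslash u]\to_{\mathsf{lsv},\varphi\cup\{y\},\mu}t'$ and $w\in S_\varphi$. \end{itemize} The restricted calculus $\lambda_{\mathsf{sn+}}$ has the same rules, except that (lsv-base) additionally requires $v\in L_{\varphi,\emptyset,\bot}$. One step of either calculus (for given $\varphi,\mu$) is a step with $\rho\in\{\mathsf{dB},\mathsf{lsv}\}$; write $\to_{\mathsf{sn}}^n$ and $\to_{\mathsf{sn+}}^m$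 for sequences of exactly $n$, resp. $m$, steps. (The top-level reduction is the case where $\mu=\top$ and $\varphi$ contains the free variables of the term.) For all $\varphi$, $\mu$, all terms $t$ and $t'\in N_\varphi$ and all $m$: if $t\to_{\mathsf{sn+}}^m t'$, then $m\le n$ for every $n$ such that $t\to_{\mathsf{sn}}^n t'$. Hence $\lambda_{\mathsf{sn+}}$ is relatively optimal: the $m$-step sequence is itself a $\lambda_{\mathsf{sn}}$ reduction sequence, so $m$ is the least length of a $\lambda_{\mathsf{sn}}$ reduction sequence from $t$ to $t'$. -/

import Mathlib

namespace StrongCBN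

/-- Lambda-terms with explicit substitutions, up to renaming of bound variables (de Bruijn indices).
`lam t` is `λx.t` and `es t u` is `t[x\u]`; both bind index `0` in `t` only. -/
inductive Term : Type
  | var (x : ℕ) : Term
  | lam (t : Term) : Term
  | app (t u : Term) : Term
  | es (t u : Term) : Term

/-- Pushes a renaming of variables under one binder. -/
def upRen (f : ℕ → ℕ) : ℕ → ℕ
  | 0 => 0
  | n + 1 => f n + 1

/-- Renaming of the free variables of a term. -/
def Term.rename : (ℕ → ℕ) → Term → Term
  | f, .var x => .var (f x)
  | f, .lam t => .lam (t.rename (upRen f))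
  | f, .app t u => .app (t.rename f) (u.rename f)
  | f, .es t u => .es (t.rename (upRen f)) (u.rename f)

/-- The same term, seen in the scope of one additional (fresh) innermost binder. -/
def Term.shift (t : Term) : Term := t.rename Nat.succ

/-- A term living under one binder, seen in the scope of one additional (fresh) binder that is
placed just outside that binder. -/
def Term.shiftUnder (t : Term) : Term := t.rename (upRen Nat.succ)

/-- Values are the lambda-abstractions. -/
def Term.IsValue (t : Term) : Prop := ∃ b : Term, t = .lam b

/-- The set `φ`, seen under a binder whose variable is not in the set. -/
def keep (φ : Set ℕ) : Set ℕ := Nat.succ '' φ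

/-- The set `φ ∪ {x}`, seen under the binder of `x`. -/
def bind (φ : Set ℕ) : Set ℕ := insert 0 (keep φ)

/-- Position flags: `top` for top-level-like positions, `bot` for the others. -/
inductive Flag : Type
  | top : Flag
  | bot : Flag

/-- `Struct φ t`: the term `t` is a structure under the set `φ` of frozen variables. -/
inductive Struct : Set ℕ → Term → Prop
  | var {φ : Set ℕ} {x : ℕ} : x ∈ φ → Struct φ (.var x)
  | app {φ : Set ℕ} {t u : Term} : Struct φ t → Struct φ (.app t u)
  | es {φ : Set ℕ} {t u : Term} : Struct (keep φ) t → Struct φ (.es t u)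
  | esStruct {φ : Set ℕ} {t u : Term} :
      Struct (bind φ) t → Struct φ u → Struct φ (.es t u)

/-- `NF φ t`: the term `t` is a normal form under the set `φ` of frozen variables. -/
inductive NF : Set ℕ → Term → Prop
  | var {φ : Set ℕ} {x : ℕ} : x ∈ φ → NF φ (.var x)
  | app {φ : Set ℕ} {t u : Term} : NF φ t → Struct φ t → NF φ u → NF φ (.app t u)
  | lam {φ : Set ℕ} {t : Term} : NF (bind φ) t → NF φ (.lam t)
  | esStruct {φ : Set ℕ} {t u : Term} :
      NF (bind φ) t → NF φ u → Struct φ u → NF φ (.es t u)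
  | es {φ : Set ℕ} {t u : Term} : NF (keep φ) t → NF φ (.es t u)

/-- `LNF φ ω μ t`: the term `t` is a local normal form at a position of flag `μ`, where `φ` is the
set of frozen variables and `ω` is a set of non-frozen variables of enclosing abstractions. -/
inductive LNF : Set ℕ → Set ℕ → Flag → Term → Prop
  | var {φ ω : Set ℕ} {μ : Flag} {x : ℕ} : x ∈ φ ∪ ω → LNF φ ω μ (.var x)
  | lamTop {φ ω : Set ℕ} {t : Term} :
      LNF (bind φ) (keep ω) .top t → LNF φ ω .top (.lam t)
  | lamBot {φ ω : Set ℕ} {t : Term} :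
      LNF (keep φ) (bind ω) .bot t → LNF φ ω .bot (.lam t)
  | es {φ ω : Set ℕ} {μ : Flag} {t u : Term} :
      LNF (keep φ) (keep ω) μ t → LNF φ ω μ (.es t u)
  | appFrozen {φ ω : Set ℕ} {μ : Flag} {t u : Term} :
      LNF φ ω μ t → Struct φ t → LNF φ ω .top u → LNF φ ω μ (.app t u)
  | appOmega {φ ω : Set ℕ} {μ : Flag} {t u : Term} :
      LNF φ ω μ t → Struct ω t → LNF φ ω μ (.app t u)
  | esFrozen {φ ω : Set ℕ} {μ : Flag} {t u : Term} :
      LNF (bind φ) (keep ω) μ t → LNF φ ω .bot u → Struct φ u → LNF φ ω μ (.es t u)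
  | esOmega {φ ω : Set ℕ} {μ : Flag} {t u : Term} :
      LNF (keep φ) (bind ω) μ t → Struct ω u → LNF φ ω μ (.es t u)

/-- Reduction rules: the two proper rules `dB` and `lsv`, and the auxiliary rules `idx x`
(probing for the variable `x`) and `sub x v` (replacing one occurrence of `x` by `v`). -/
inductive Rule : Type
  | dB : Rule
  | lsv : Rule
  | idx (x : ℕ) : Rule
  | sub (x : ℕ) (v : Term) : Rule

/-- A rule, seen under one additional binder (whose variable does not occur in the rule). -/
def Rule.shift : Rule → Rule
  | .dB => .dB
  | .lsv => .lsv
  | .idx x => .idx (x + 1)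
  | .sub x v => .sub (x + 1) v.shift

/-- Beta-reduction at a distance, `(λx.t)L u ↦ t[x\u]L` with `L` a list of substitutions. -/
inductive AuxDB : Term → Term → Prop
  | base {t u : Term} : AuxDB (.app (.lam t) u) (.es t u)
  | sigma {t u w s : Term} :
      AuxDB (.app t u.shift) s → AuxDB (.app (.es t w) u) (.es s w)

/-- The strong call-by-need calculus `sn` and its restriction `snPlus`. -/
inductive Calculus : Type
  | sn : Calculus
  | snPlus : Calculus

mutual

/-- `Step c ρ φ μ t t'`: in the calculus `c`, the term `t` reduces to `t'` by the rule `ρ`, at a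
position of flag `μ` where the variables of `φ` are frozen. -/
inductive Step (c : Calculus) : Rule → Set ℕ → Flag → Term → Term → Prop
  | appLeft {ρ : Rule} {φ : Set ℕ} {μ : Flag} {t t' u : Term} :
      Step c ρ φ .bot t t' → Step c ρ φ μ (.app t u) (.app t' u)
  | appRight {ρ : Rule} {φ : Set ℕ} {μ : Flag} {t u u' : Term} :
      Struct φ t → Step c ρ φ .top u u' → Step c ρ φ μ (.app t u) (.app t u')
  | lamTop {ρ : Rule} {φ : Set ℕ} {t t' : Term} :
      Step c ρ.shift (bind φ) .top t t' → Step c ρ φ .top (.lam t) (.lam t')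
  | lamBot {ρ : Rule} {φ : Set ℕ} {t t' : Term} :
      Step c ρ.shift (keep φ) .bot t t' → Step c ρ φ .bot (.lam t) (.lam t')
  | esLeft {ρ : Rule} {φ : Set ℕ} {μ : Flag} {t t' u : Term} :
      Step c ρ.shift (keep φ) μ t t' → Step c ρ φ μ (.es t u) (.es t' u)
  | esLeftStruct {ρ : Rule} {φ : Set ℕ} {μ : Flag} {t t' u : Term} :
      Step c ρ.shift (bind φ) μ t t' → Struct φ u → Step c ρ φ μ (.es t u) (.es t' u)
  | esRight {ρ : Rule} {φ : Set ℕ} {μ : Flag} {t u u' : Term} :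
      Step c (.idx 0) (keep φ) μ t t → Step c ρ φ .bot u u' →
      Step c ρ φ μ (.es t u) (.es t u')
  | idx {φ : Set ℕ} {μ : Flag} {x : ℕ} : Step c (.idx x) φ μ (.var x) (.var x)
  | sub {φ : Set ℕ} {μ : Flag} {x : ℕ} {v : Term} : Step c (.sub x v) φ μ (.var x) v
  | dB {φ : Set ℕ} {μ : Flag} {t t' : Term} : AuxDB t t' → Step c .dB φ μ t t'
  | lsv {φ : Set ℕ} {μ : Flag} {t t' : Term} : AuxLSV c φ μ t t' → Step c .lsv φ μ t t'

/-- Linear substitution of a value, `C[x][x\vL] ↦ C[v][x\v]L` with `L` a list of substitutions.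
In `snPlus`, the value must moreover be a local normal form. -/
inductive AuxLSV (c : Calculus) : Set ℕ → Flag → Term → Term → Prop
  | base {φ : Set ℕ} {μ : Flag} {t t' v : Term} :
      Step c (.sub 0 v.shift) (keep φ) μ t t' → v.IsValue →
      (c = .snPlus → LNF φ ∅ .bot v) →
      AuxLSV c φ μ (.es t v) (.es t' v)
  | sigma {φ : Set ℕ} {μ : Flag} {t u w t' : Term} :
      AuxLSV c (keep φ) μ (.es t.shiftUnder u) t' →
      AuxLSV c φ μ (.es t (.es u w)) (.es t' w)
  | sigmaStruct {φ : Set ℕ} {μ : Flag} {t u w t' : Term} :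
      AuxLSV c (bind φ) μ (.es t.shiftUnder u) t' → Struct φ w →
      AuxLSV c φ μ (.es t (.es u w)) (.es t' w)

end

/-- One reduction step of the calculus `c`: a step by one of the two proper rules. -/
def Red (c : Calculus) (φ : Set ℕ) (μ : Flag) (t t' : Term) : Prop :=
  Step c .dB φ μ t t' ∨ Step c .lsv φ μ t t'

/-- Reduction sequences of the calculus `c` with exactly `n` steps. -/
inductive RedSeq (c : Calculus) (φ : Set ℕ) (μ : Flag) : ℕ → Term → Term → Prop
  | refl {t : Term} : RedSeq c φ μ 0 t t
  | step {n : ℕ} {t s t' : Term} :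
      Red c φ μ t s → RedSeq c φ μ n s t' → RedSeq c φ μ (n + 1) t t'

end StrongCBN

/-!
The length of a sequence of restricted steps is compared with that of a sequence of full steps by
one inequality: if `k + 1` restricted steps can be performed from `t` and `t` makes one full step
to `s`, then `k` restricted steps can be performed from `s` (`HasSeq.sn_step`). Since no step
starts from a normal form, a sequence of `n` full steps from `t` to a normal form bounds by `n` the
length of every restricted sequence from `t`. Nothing has to be known about the end of the
restricted sequences, nor about the confluence of the full calculus.

*Flat terms.* The rules at a distance are removed first. A substitution at the head of an
application or at the root of the content of another substitution is moved outwards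
(`Term.flat`). The images of the steps are steps of a calculus `CStep` on flat terms, where `dB`
and `lsv` are local rules (`Step.flat`, `AuxLSV.flat`). Only this direction of the simulation is
needed. The probing rule becomes the predicate `Reach`, which is common to both calculi.

*Commutation.* A restricted step `t → t₁` and a full step `t → s` commute (`CStep.joined`): unless
`t₁ = s`, there are a full step `t₁ → t₃` and a restricted step `s → s'`, where `s'` and `t₃` are
nearly equal. They differ when the full step copies a value that the restricted step reduces: the
restricted step is performed on the copy in `s'`, while the original is reduced in `t₃` but not in
`s'`. A restricted step never copies a reducible value, because local normal forms have no step
(`LNF.not_step`).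

*Latent steps.* The original above may be unreachable, so `s'` and `t₃` are related by steps
inside contents of substitutions that are possibly not reachable (`Latent`). A latent step is
either an actual restricted step, or it can be postponed after any restricted step
(`Latent.postpone`), at the price of being multiplied. Hence `k` restricted steps can be performed
before a latent step as soon as they can be performed after it (`HasSeq.of_latent`), and the
inequality follows by induction on `k`.
-/

namespace StrongCBN

open Set Relation

/-! ### Renaming -/

theorem upRen_comp (f g : ℕ → ℕ) :
    (fun n => upRen f (upRen g n)) = upRen (fun n => f (g n)) := by
  funext n; cases n <;> rfl

theorem upRen_id : upRen (fun n => n) = fun n => n := by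
  funext n; cases n <;> rfl

theorem Term.rename_rename (t : Term) (f g : ℕ → ℕ) :
    (t.rename g).rename f = t.rename (fun n => f (g n)) := by
  induction t generalizing f g with
  | var x => rfl
  | lam t ih => simp [Term.rename, ih, upRen_comp]
  | app t u iht ihu => simp [Term.rename, iht, ihu]
  | es t u iht ihu => simp [Term.rename, iht, ihu, upRen_comp]

theorem Term.rename_id (t : Term) : t.rename (fun n => n) = t := by
  induction t with
  | var x => rfl
  | lam t ih => simp [Term.rename, ih, upRen_id]
  | app t u iht ihu => simp [Term.rename, iht, ihu]
  | es t u iht ihu => simp [Term.rename, iht, ihu, upRen_id]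

theorem Term.shift_rename (t : Term) (f : ℕ → ℕ) :
    t.shift.rename (upRen f) = (t.rename f).shift := by
  simp [Term.shift, Term.rename_rename, upRen]

theorem Term.shiftUnder_rename (t : Term) (f : ℕ → ℕ) :
    t.shiftUnder.rename (upRen (upRen f)) = (t.rename (upRen f)).shiftUnder := by
  simp only [Term.shiftUnder, Term.rename_rename, upRen_comp]
  rfl

theorem Term.shift_shiftUnder (t : Term) : t.shift.shiftUnder = t.shift.shift :=
  t.shift_rename Nat.succ

theorem Term.shiftUnder_shiftUnder (t : Term) :
    t.shiftUnder.rename (upRen (upRen Nat.succ)) = t.shiftUnder.shiftUnder :=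
  t.shiftUnder_rename Nat.succ

/-! ### Sets of frozen variables under a binder -/

@[simp] theorem zero_notMem_keep {φ : Set ℕ} : (0 ∈ keep φ) ↔ False := by simp [keep]
@[simp] theorem succ_mem_keep {φ : Set ℕ} {n : ℕ} : n + 1 ∈ keep φ ↔ n ∈ φ := by simp [keep]
@[simp] theorem zero_mem_bind {φ : Set ℕ} : 0 ∈ bind φ := by simp [bind]
@[simp] theorem succ_mem_bind {φ : Set ℕ} {n : ℕ} : n + 1 ∈ bind φ ↔ n ∈ φ := by
  simp [bind]

/-- The set of frozen variables in the scope of an explicit substitution whose content is `u`: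
the bound variable is frozen exactly when `u` is a structure. It merges the two rules `esLeft` and
`esLeftStruct` into one. -/
def ext (φ : Set ℕ) (u : Term) : Set ℕ := {n | (n = 0 ∧ Struct φ u) ∨ n ∈ keep φ}

@[simp] theorem zero_mem_ext {φ : Set ℕ} {u : Term} : 0 ∈ ext φ u ↔ Struct φ u := by simp [ext]
@[simp] theorem succ_mem_ext {φ : Set ℕ} {u : Term} {n : ℕ} : n + 1 ∈ ext φ u ↔ n ∈ φ := by
  simp [ext]

theorem ext_of_struct {φ : Set ℕ} {u : Term} (h : Struct φ u) : ext φ u = bind φ := by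
  ext n; cases n <;> simp [h]

theorem ext_of_not_struct {φ : Set ℕ} {u : Term} (h : ¬ Struct φ u) : ext φ u = keep φ := by
  ext n; cases n <;> simp [h]

section MapsTo
variable {f : ℕ → ℕ} {φ ψ : Set ℕ}

theorem mapsTo_keep (h : MapsTo f φ ψ) : MapsTo (upRen f) (keep φ) (keep ψ) := by
  intro n hn; cases n with
  | zero => simp at hn
  | succ n => simpa [upRen] using h (by simpa using hn)

theorem mapsTo_bind (h : MapsTo f φ ψ) : MapsTo (upRen f) (bind φ) (bind ψ) := by
  intro n hn; cases n with
  | zero => simp [upRen]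
  | succ n => simpa [upRen] using h (by simpa using hn)

theorem mapsTo_keep_bind (h : MapsTo f φ ψ) : MapsTo (upRen f) (keep φ) (bind ψ) := by
  intro n hn; cases n with
  | zero => simp [upRen]
  | succ n => simpa [upRen] using h (by simpa using hn)

theorem mapsTo_ext {u u' : Term} (h : MapsTo f φ ψ) (hu : Struct φ u → Struct ψ u') :
    MapsTo (upRen f) (ext φ u) (ext ψ u') := by
  intro n hn; cases n with
  | zero => simpa [upRen] using hu (by simpa using hn)
  | succ n => simpa [upRen] using h (by simpa using hn)

end MapsTo

theorem keep_mono {φ ψ : Set ℕ} (h : φ ⊆ ψ) : keep φ ⊆ keep ψ := by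
  intro n hn; cases n with
  | zero => simp at hn
  | succ n => simpa using h (by simpa using hn)

theorem bind_mono {φ ψ : Set ℕ} (h : φ ⊆ ψ) : bind φ ⊆ bind ψ := by
  intro n hn; cases n with
  | zero => simp
  | succ n => simpa using h (by simpa using hn)

theorem ext_mono' {φ ψ : Set ℕ} {u u' : Term} (h : φ ⊆ ψ) (hu : Struct φ u → Struct ψ u') :
    ext φ u ⊆ ext ψ u' := by
  intro n hn; cases n with
  | zero => simpa using hu (by simpa using hn)
  | succ n => simpa using h (by simpa using hn)

theorem keep_subset_bind {φ : Set ℕ} : keep φ ⊆ bind φ := fun _ => Or.inr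

theorem keep_subset_ext {φ : Set ℕ} {u : Term} : keep φ ⊆ ext φ u := fun _ => Or.inr

theorem bind_subset_ext {φ : Set ℕ} {u : Term} (h : Struct φ u) : bind φ ⊆ ext φ u :=
  (ext_of_struct h).ge

/-! ### Structures -/

theorem Struct.map {f : ℕ → ℕ} {φ ψ : Set ℕ} {t : Term} (h : Struct φ t) (hf : MapsTo f φ ψ) :
    Struct ψ (t.rename f) := by
  induction h generalizing f ψ with
  | var h => exact .var (hf h)
  | app _ ih => exact .app (ih hf)
  | es _ ih => exact .es (ih (mapsTo_keep hf))
  | esStruct _ _ ih ih' => exact .esStruct (ih (mapsTo_bind hf)) (ih' hf)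

theorem Struct.mono {φ ψ : Set ℕ} {t : Term} (h : Struct φ t) (hf : φ ⊆ ψ) : Struct ψ t := by
  simpa [Term.rename_id] using h.map (f := fun n => n) (ψ := ψ) hf

theorem ext_mono {φ ψ : Set ℕ} {u : Term} (h : φ ⊆ ψ) : ext φ u ⊆ ext ψ u :=
  ext_mono' h fun hu => hu.mono h

theorem struct_var_iff {φ : Set ℕ} {x : ℕ} : Struct φ (.var x) ↔ x ∈ φ :=
  ⟨fun h => by cases h; assumption, .var⟩

theorem not_struct_lam {φ : Set ℕ} {t : Term} : ¬ Struct φ (.lam t) := nofun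

theorem struct_app_iff {φ : Set ℕ} {t u : Term} : Struct φ (.app t u) ↔ Struct φ t :=
  ⟨fun h => by cases h; assumption, .app⟩

theorem struct_es_iff {φ : Set ℕ} {t u : Term} : Struct φ (.es t u) ↔ Struct (ext φ u) t := by
  constructor
  · intro h
    cases h with
    | es h => exact h.mono keep_subset_ext
    | esStruct h hu => exact h.mono (bind_subset_ext hu)
  · intro h
    by_cases hu : Struct φ u
    · exact .esStruct (by rwa [ext_of_struct hu] at h) hu
    · exact .es (by rwa [ext_of_not_struct hu] at h)

theorem ext_lam {φ : Set ℕ} {b : Term} : ext φ (.lam b) = keep φ := ext_of_not_struct not_struct_lam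

/-- A structure has a single head variable, so the sets that make it a structure can be
intersected. -/
theorem Struct.inter {φ ψ : Set ℕ} {t : Term} (h : Struct φ t) (h' : Struct ψ t) :
    Struct (φ ∩ ψ) t := by
  induction t generalizing φ ψ with
  | var x => rw [struct_var_iff] at *; exact ⟨h, h'⟩
  | lam t => exact absurd h not_struct_lam
  | app t u ih => rw [struct_app_iff] at *; exact ih h h'
  | es t u ih ihu =>
    rw [struct_es_iff] at *
    refine (ih h h').mono ?_
    rintro (_ | n) ⟨h1, h2⟩
    · simp only [zero_mem_ext] at *; exact ihu h1 h2
    · simp only [succ_mem_ext] at *; exact ⟨h1, h2⟩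

theorem not_struct_empty {t : Term} : ¬ Struct ∅ t := by
  suffices ∀ φ : Set ℕ, φ = ∅ → ¬ Struct φ t from this _ rfl
  induction t with
  | var x => rintro _ rfl; simp [struct_var_iff]
  | lam t => intro _ _; exact not_struct_lam
  | app t u ih => intro φ hφ; rw [struct_app_iff]; exact ih φ hφ
  | es t u ih ihu =>
    intro φ hφ; rw [struct_es_iff]
    refine ih _ ?_
    rw [ext_of_not_struct (ihu φ hφ), hφ, keep, image_empty]

theorem Struct.not_struct_of_disjoint {φ ψ : Set ℕ} {t : Term} (h : Struct φ t)
    (hd : Disjoint φ ψ) : ¬ Struct ψ t := fun h' =>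
  not_struct_empty (hd.inter_eq ▸ h.inter h')

theorem disjoint_keep_keep {φ ψ : Set ℕ} (h : Disjoint φ ψ) : Disjoint (keep φ) (keep ψ) := by
  rw [disjoint_left] at *
  rintro (_ | n) h1 h2
  · simp at h1
  · simp only [succ_mem_keep] at *; exact h h1 h2

theorem disjoint_ext_keep {φ ψ : Set ℕ} {u : Term} (h : Disjoint φ ψ) :
    Disjoint (ext φ u) (keep ψ) := by
  rw [disjoint_left] at *
  rintro (_ | n) h1 h2
  · simp at h2
  · simp only [succ_mem_keep, succ_mem_ext] at *; exact h h1 h2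

theorem disjoint_bind_keep {φ ψ : Set ℕ} (h : Disjoint φ ψ) :
    Disjoint (bind φ) (keep ψ) := by
  rw [disjoint_left] at *
  rintro (_ | n) h1 h2
  · simp at h2
  · simp only [succ_mem_keep, succ_mem_bind] at *; exact h h1 h2

theorem disjoint_keep_bind {φ ψ : Set ℕ} (h : Disjoint φ ψ) :
    Disjoint (keep φ) (bind ψ) := (disjoint_bind_keep h.symm).symm

/-! ### Flattening -/

/-- The explicit substitution `t[x\u]`, with the substitutions at the root of `u` moved outwards:
`t[x\u[y\w]]` becomes `t[x\u][y\w]`. -/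
def esB : Term → Term → Term
  | t, .es u w => .es (esB t.shiftUnder u) w
  | t, .var x => .es t (.var x)
  | t, .lam b => .es t (.lam b)
  | t, .app u w => .es t (.app u w)

/-- The application `t u`, with the substitutions at the root of `t` moved outwards:
`t[x\w] u` becomes `(t u)[x\w]`. -/
def appB : Term → Term → Term
  | .es t w, u => .es (appB t u.shift) w
  | .var x, u => .app (.var x) u
  | .lam b, u => .app (.lam b) u
  | .app t w, u => .app (.app t w) u

/-- The flat form of a term: no explicit substitution remains at the head of an application or at
the root of the content of another one. -/
def Term.flat : Term → Term
  | .var x => .var x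
  | .lam t => .lam t.flat
  | .app t u => appB t.flat u.flat
  | .es t u => esB t.flat u.flat

/-- The root of the term is not an explicit substitution. -/
def Term.NotEs : Term → Prop
  | .es _ _ => False
  | _ => True

theorem esB_of_notEs {t u : Term} (h : u.NotEs) : esB t u = .es t u := by
  cases u <;> first | rfl | exact h.elim

theorem appB_of_notEs {t u : Term} (h : t.NotEs) : appB t u = .app t u := by
  cases t <;> first | rfl | exact h.elim

theorem esB_rename (t u : Term) (f : ℕ → ℕ) :
    (esB t u).rename f = esB (t.rename (upRen f)) (u.rename f) := by
  induction u generalizing t f with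
  | es u w ih => simp [esB, Term.rename, ih, Term.shiftUnder_rename]
  | _ => simp [esB, Term.rename]

theorem appB_rename (t u : Term) (f : ℕ → ℕ) :
    (appB t u).rename f = appB (t.rename f) (u.rename f) := by
  induction t generalizing u f with
  | es t w ih => simp [appB, Term.rename, ih, Term.shift_rename]
  | _ => simp [appB, Term.rename]

theorem Term.flat_rename (t : Term) (f : ℕ → ℕ) : (t.rename f).flat = t.flat.rename f := by
  induction t generalizing f with
  | var x => rfl
  | lam t ih => simp [Term.rename, Term.flat, ih]
  | app t u iht ihu => simp [Term.rename, Term.flat, iht, ihu, appB_rename]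
  | es t u iht ihu => simp [Term.rename, Term.flat, iht, ihu, esB_rename]

theorem esB_assoc (t u w : Term) : esB t (esB u w) = esB (esB t.shiftUnder u) w := by
  induction w generalizing t u with
  | es w z ih =>
    simp only [esB, ih]
    congr 2
    conv_rhs => rw [Term.shiftUnder, esB_rename, Term.shiftUnder_shiftUnder]
    rfl
  | _ => simp [esB]

theorem appB_esB (t w u : Term) : appB (esB t w) u = esB (appB t u.shift) w := by
  induction w generalizing t u with
  | es w z ih =>
    simp only [esB, appB, ih]
    congr 2
    rw [Term.shiftUnder, Term.shiftUnder, appB_rename]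
    congr 1
    exact u.shift_shiftUnder.symm
  | _ => simp [esB, appB]

theorem struct_rename_iff {φ : Set ℕ} {t : Term} {f : ℕ → ℕ} :
    Struct φ (t.rename f) ↔ Struct (f ⁻¹' φ) t := by
  induction t generalizing φ f with
  | var x => simp [Term.rename, struct_var_iff]
  | lam t => simp [Term.rename, not_struct_lam]
  | app t u ih => simp [Term.rename, struct_app_iff, ih]
  | es t u ih ihu =>
    have : upRen f ⁻¹' ext φ (u.rename f) = ext (f ⁻¹' φ) u := by
      ext n; cases n <;> simp [upRen, ihu]
    simp [Term.rename, struct_es_iff, ih, this]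

theorem struct_esB_iff {φ : Set ℕ} {t u : Term} : Struct φ (esB t u) ↔ Struct (ext φ u) t := by
  induction u generalizing φ t with
  | es u w ih =>
    have : upRen Nat.succ ⁻¹' ext (ext φ w) u = ext φ (.es u w) := by
      ext n; cases n <;> simp [upRen, struct_es_iff]
    rw [esB, struct_es_iff, ih, Term.shiftUnder, struct_rename_iff, this]
  | _ => exact struct_es_iff

theorem struct_appB_iff {φ : Set ℕ} {t u : Term} : Struct φ (appB t u) ↔ Struct φ t := by
  induction t generalizing φ u with
  | es t w ih => rw [appB, struct_es_iff, struct_es_iff, ih]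
  | _ => exact struct_app_iff

/-! ### Local normal forms -/

theorem LNF.map {f : ℕ → ℕ} {φ φ' ω ω' : Set ℕ} {μ : Flag} {t : Term} (h : LNF φ ω μ t)
    (hφ : MapsTo f φ φ') (hω : MapsTo f ω ω') : LNF φ' ω' μ (t.rename f) := by
  induction h generalizing f φ' ω' with
  | var h => exact .var (h.imp (fun h => hφ h) (fun h => hω h))
  | lamTop _ ih => exact .lamTop (ih (mapsTo_bind hφ) (mapsTo_keep hω))
  | lamBot _ ih => exact .lamBot (ih (mapsTo_keep hφ) (mapsTo_bind hω))
  | es _ ih => exact .es (ih (mapsTo_keep hφ) (mapsTo_keep hω))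
  | appFrozen _ hs _ ih ih' => exact .appFrozen (ih hφ hω) (hs.map hφ) (ih' hφ hω)
  | appOmega _ hs ih => exact .appOmega (ih hφ hω) (hs.map hω)
  | esFrozen _ _ hs ih ih' =>
    exact .esFrozen (ih (mapsTo_bind hφ) (mapsTo_keep hω)) (ih' hφ hω) (hs.map hφ)
  | esOmega _ hs ih => exact .esOmega (ih (mapsTo_keep hφ) (mapsTo_bind hω)) (hs.map hω)

theorem LNF.flag_of_struct {φ ω ψ : Set ℕ} {μ μ' : Flag} {t : Term} (h : LNF φ ω μ t)
    (hs : Struct ψ t) : LNF φ ω μ' t := by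
  induction h generalizing ψ with
  | var h => exact .var h
  | lamTop _ ih => exact absurd hs not_struct_lam
  | lamBot _ ih => exact absurd hs not_struct_lam
  | es _ ih => exact .es (ih (struct_es_iff.1 hs))
  | appFrozen _ hs' hu ih ih' => exact .appFrozen (ih (struct_app_iff.1 hs)) hs' hu
  | appOmega _ hs' ih => exact .appOmega (ih (struct_app_iff.1 hs)) hs'
  | esFrozen _ hu hs' ih ih' => exact .esFrozen (ih (struct_es_iff.1 hs)) hu hs'
  | esOmega _ hs' ih => exact .esOmega (ih (struct_es_iff.1 hs)) hs'

/-- The head variable of a local normal form belongs to the two sets that describe it. -/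
theorem LNF.struct_inter {φ ω ψ : Set ℕ} {μ : Flag} {t : Term} (h : LNF φ ω μ t)
    (hs : Struct ψ t) : Struct (ψ ∩ (φ ∪ ω)) t := by
  induction h generalizing ψ with
  | var h => exact .var ⟨struct_var_iff.1 hs, h⟩
  | lamTop _ ih => exact absurd hs not_struct_lam
  | lamBot _ ih => exact absurd hs not_struct_lam
  | es _ ih =>
    refine .es ((ih (struct_es_iff.1 hs)).mono ?_)
    rintro (_ | n) ⟨h1, h2⟩ <;> simp at *
    exact ⟨h1, h2⟩
  | appFrozen _ hs' hu ih ih' => exact .app (ih (struct_app_iff.1 hs))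
  | appOmega _ hs' ih => exact .app (ih (struct_app_iff.1 hs))
  | esFrozen _ hu hs' ih ih' =>
    refine struct_es_iff.2 ((ih (struct_es_iff.1 hs)).mono ?_)
    rintro (_ | n) ⟨h1, h2⟩ <;> simp at *
    exacts [ih' h1, ⟨h1, h2⟩]
  | esOmega _ hs' ih =>
    refine struct_es_iff.2 ((ih (struct_es_iff.1 hs)).mono ?_)
    rintro (_ | n) ⟨h1, h2⟩ <;> simp at *
    exacts [(h1.inter hs').mono fun n h => ⟨h.1, .inr h.2⟩, ⟨h1, h2⟩]

theorem LNF.struct_keep_left {φ ω ψ : Set ℕ} {w t : Term} {μ : Flag}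
    (h : LNF (keep φ) (keep ω) μ t) (hs : Struct (ext ψ w) t) : Struct (keep ψ) t := by
  refine (h.struct_inter hs).mono ?_
  rintro (_ | n) ⟨h1, h2⟩ <;> simp at *
  exact h1

theorem LNF.esB {φ ω : Set ℕ} {μ : Flag} {t u : Term} (h : LNF (keep φ) (keep ω) μ t) :
    LNF φ ω μ (esB t u) := by
  induction u generalizing φ ω t with
  | es u w ih =>
    exact .es (ih (h.map (mapsTo_keep fun n hn => by simpa using hn)
      (mapsTo_keep fun n hn => by simpa using hn)))
  | _ => exact .es h

theorem LNF.esB_omega {φ ω : Set ℕ} {μ : Flag} {t u : Term} (h : LNF (keep φ) (bind ω) μ t)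
    (hs : Struct ω u) : LNF φ ω μ (StrongCBN.esB t u) := by
  induction u generalizing φ ω t with
  | es u w ih =>
    cases hs with
    | es hs =>
      exact .es (ih (h.map (mapsTo_keep fun n hn => by simpa using hn)
        (mapsTo_bind fun n hn => by simpa using hn)) hs)
    | esStruct hs hw =>
      exact .esOmega (ih (h.map (mapsTo_keep fun n hn => by simpa using hn)
        (mapsTo_bind fun n hn => by simpa using hn)) hs) hw
  | _ => exact .esOmega h hs

theorem LNF.esB_frozen {φ ω : Set ℕ} {μ : Flag} {t u : Term} (h : LNF (bind φ) (keep ω) μ t)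
    (hu : LNF φ ω .bot u) (hs : Struct φ u) (hd : Disjoint φ ω) :
    LNF φ ω μ (StrongCBN.esB t u) := by
  induction u generalizing φ ω t with
  | es u w ih =>
    rw [struct_es_iff] at hs
    cases hu with
    | es hu =>
      exact .es (ih (h.map (mapsTo_bind fun n hn => by simpa using hn)
        (mapsTo_keep fun n hn => by simpa using hn)) hu (hu.struct_keep_left hs)
        (disjoint_keep_keep hd))
    | esFrozen hu hw hsw =>
      rw [ext_of_struct hsw] at hs
      exact .esFrozen (ih (h.map (mapsTo_bind fun n hn => by simpa using hn)
        (mapsTo_keep fun n hn => by simpa using hn)) hu hs (disjoint_bind_keep hd)) hw hsw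
    | esOmega hu hsw =>
      rw [ext_of_not_struct (hsw.not_struct_of_disjoint hd.symm)] at hs
      exact .esOmega (ih (h.map (mapsTo_bind fun n hn => by simpa using hn)
        (mapsTo_keep fun n hn => by simpa using hn)) hu hs (disjoint_keep_bind hd)) hsw
  | _ => exact .esFrozen h hu hs

theorem LNF.appB_frozen {φ ω : Set ℕ} {μ : Flag} {t u : Term} (h : LNF φ ω μ t)
    (hs : Struct φ t) (hu : LNF φ ω .top u) (hd : Disjoint φ ω) :
    LNF φ ω μ (appB t u) := by
  induction t generalizing φ ω u with
  | es t w ih =>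
    rw [struct_es_iff] at hs
    cases h with
    | es h =>
      exact .es (ih h (h.struct_keep_left hs) (hu.map (fun n hn => by simpa using hn)
        (fun n hn => by simpa using hn)) (disjoint_keep_keep hd))
    | esFrozen h hw hsw =>
      rw [ext_of_struct hsw] at hs
      exact .esFrozen (ih h hs (hu.map (fun n hn => by simpa using hn)
        (fun n hn => by simpa using hn)) (disjoint_bind_keep hd)) hw hsw
    | esOmega h hsw =>
      rw [ext_of_not_struct (hsw.not_struct_of_disjoint hd.symm)] at hs
      exact .esOmega (ih h hs (hu.map (fun n hn => by simpa using hn)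
        (fun n hn => by simpa using hn)) (disjoint_keep_bind hd)) hsw
  | _ => exact .appFrozen h hs hu

theorem LNF.appB_omega {φ ω : Set ℕ} {μ : Flag} {t u : Term} (h : LNF φ ω μ t)
    (hs : Struct ω t) (hd : Disjoint φ ω) : LNF φ ω μ (appB t u) := by
  induction t generalizing φ ω u with
  | es t w ih =>
    rw [struct_es_iff] at hs
    cases h with
    | es h => exact .es (ih h (h.struct_keep_left hs) (disjoint_keep_keep hd))
    | esFrozen h hw hsw =>
      rw [ext_of_not_struct (hsw.not_struct_of_disjoint hd)] at hs
      exact .esFrozen (ih h hs (disjoint_bind_keep hd)) hw hsw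
    | esOmega h hsw =>
      rw [ext_of_struct hsw] at hs
      exact .esOmega (ih h hs (disjoint_keep_bind hd)) hsw
  | _ => exact .appOmega h hs

theorem Struct.flat {φ : Set ℕ} {t : Term} (h : Struct φ t) : Struct φ t.flat := by
  induction h with
  | var h => exact .var h
  | app _ ih => exact struct_appB_iff.2 ih
  | es _ ih => exact struct_esB_iff.2 (ih.mono keep_subset_ext)
  | esStruct _ _ ih ih' => exact struct_esB_iff.2 (ih.mono (bind_subset_ext ih'))

theorem LNF.flat {φ ω : Set ℕ} {μ : Flag} {t : Term} (h : LNF φ ω μ t) (hd : Disjoint φ ω) :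
    LNF φ ω μ t.flat := by
  induction h with
  | var h => exact .var h
  | lamTop _ ih => exact .lamTop (ih (disjoint_bind_keep hd))
  | lamBot _ ih => exact .lamBot (ih (disjoint_keep_bind hd))
  | es _ ih => exact .esB (ih (disjoint_keep_keep hd))
  | appFrozen _ hs _ ih ih' => exact .appB_frozen (ih hd) hs.flat (ih' hd) hd
  | appOmega _ hs ih => exact .appB_omega (ih hd) hs.flat hd
  | esFrozen _ _ hs ih ih' => exact .esB_frozen (ih (disjoint_bind_keep hd)) (ih' hd) hs.flat hd
  | esOmega _ hs ih => exact .esB_omega (ih (disjoint_keep_bind hd)) hs.flat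

theorem NF.lnf {φ : Set ℕ} {t : Term} (h : NF φ t) : LNF φ ∅ .top t := by
  have he : keep ∅ = ∅ := image_empty _
  induction h with
  | var h => exact .var (.inl h)
  | app _ hs _ ih ih' => exact .appFrozen ih hs ih'
  | lam _ ih => exact .lamTop (by rwa [he])
  | esStruct _ _ hs ih ih' => exact .esFrozen (by rwa [he]) (ih'.flag_of_struct hs) hs
  | es _ ih => exact .es (by rwa [he])

/-! ### Reachable variables -/

/-- `Reach x φ μ t`: some occurrence of the free variable `x` is at an evaluation position of `t`,
for a position of flag `μ` and frozen variables `φ`. -/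
inductive Reach : ℕ → Set ℕ → Flag → Term → Prop
  | var {x : ℕ} {φ : Set ℕ} {μ : Flag} : Reach x φ μ (.var x)
  | appL {x : ℕ} {φ : Set ℕ} {μ : Flag} {t u : Term} : Reach x φ .bot t → Reach x φ μ (.app t u)
  | appR {x : ℕ} {φ : Set ℕ} {μ : Flag} {t u : Term} :
      Struct φ t → Reach x φ .top u → Reach x φ μ (.app t u)
  | lamTop {x : ℕ} {φ : Set ℕ} {t : Term} :
      Reach (x + 1) (bind φ) .top t → Reach x φ .top (.lam t)
  | lamBot {x : ℕ} {φ : Set ℕ} {t : Term} :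
      Reach (x + 1) (keep φ) .bot t → Reach x φ .bot (.lam t)
  | esL {x : ℕ} {φ : Set ℕ} {μ : Flag} {t u : Term} :
      Reach (x + 1) (ext φ u) μ t → Reach x φ μ (.es t u)
  | esR {x : ℕ} {φ : Set ℕ} {μ : Flag} {t u : Term} :
      Reach 0 (keep φ) μ t → Reach x φ .bot u → Reach x φ μ (.es t u)

theorem Reach.map {x : ℕ} {f : ℕ → ℕ} {φ ψ : Set ℕ} {μ μ' : Flag} {t : Term}
    (h : Reach x φ μ t) (hf : MapsTo f φ ψ) (hμ : μ = .top → μ' = .top) :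
    Reach (f x) ψ μ' (t.rename f) := by
  induction h generalizing f ψ μ' with
  | var => exact .var
  | appL _ ih => exact .appL (ih hf nofun)
  | appR hs _ ih => exact .appR (hs.map hf) (ih hf fun _ => rfl)
  | lamTop _ ih => obtain rfl := hμ rfl; exact .lamTop (ih (mapsTo_bind hf) fun _ => rfl)
  | lamBot _ ih =>
    cases μ' with
    | top => exact .lamTop (ih (mapsTo_keep_bind hf) nofun)
    | bot => exact .lamBot (ih (mapsTo_keep hf) nofun)
  | esL _ ih => exact .esL (ih (mapsTo_ext hf fun hu => hu.map hf) hμ)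
  | esR _ _ ih ih' => exact .esR (ih (mapsTo_keep hf) hμ) (ih' hf nofun)

theorem Reach.mono {x : ℕ} {φ ψ : Set ℕ} {μ μ' : Flag} {t : Term}
    (h : Reach x φ μ t) (hf : φ ⊆ ψ) (hμ : μ = .top → μ' = .top) : Reach x ψ μ' t := by
  simpa [Term.rename_id] using h.map (f := fun n => n) (ψ := ψ) hf hμ

theorem Reach.shift {x : ℕ} {φ : Set ℕ} {μ : Flag} {t : Term} (h : Reach x φ μ t) :
    Reach (x + 1) (keep φ) μ t.shift :=
  h.map (fun n hn => by simpa using hn) id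

/-- Renaming by `shiftUnder` accompanies the change of frozen variables from `t[x\u[y\w]]` to
`t[x\u][y\w]`. -/
theorem mapsTo_ext_es {φ : Set ℕ} {u w : Term} :
    MapsTo (upRen Nat.succ) (ext φ (.es u w)) (ext (ext φ w) u) :=
  mapsTo_ext (fun n hn => by simpa using hn) struct_es_iff.1

theorem Reach.esB_left {x : ℕ} {φ : Set ℕ} {μ : Flag} {t u : Term}
    (h : Reach (x + 1) (ext φ u) μ t) : Reach x φ μ (esB t u) := by
  induction u generalizing x φ t with
  | es u w ih => exact .esL (ih (h.map mapsTo_ext_es id))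
  | _ => exact .esL h

theorem Reach.esB_right {x : ℕ} {φ : Set ℕ} {μ : Flag} {t u : Term}
    (ht : Reach 0 (keep φ) μ t) (h : Reach x φ .bot u) : Reach x φ μ (esB t u) := by
  induction u generalizing x φ t with
  | es u w ih =>
    have ht' : Reach 0 (keep (keep φ)) μ t.shiftUnder :=
      ht.map (mapsTo_keep fun n hn => by simpa using hn) id
    cases h with
    | esL h => exact .esL (ih (ht'.mono (keep_mono keep_subset_ext) id) h)
    | esR h hw => exact .esR (ih ht' h) hw
  | _ => exact .esR ht h

theorem Reach.appB_left {x : ℕ} {φ : Set ℕ} {μ : Flag} {t u : Term}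
    (h : Reach x φ .bot t) : Reach x φ μ (appB t u) := by
  induction t generalizing x φ u with
  | es t w ih =>
    cases h with
    | esL h => exact .esL (ih h)
    | esR h hw => exact .esR (ih h) hw
  | _ => exact .appL h

theorem Reach.appB_right {x : ℕ} {φ : Set ℕ} {μ : Flag} {t u : Term}
    (hs : Struct φ t) (h : Reach x φ .top u) : Reach x φ μ (appB t u) := by
  induction t generalizing x φ u with
  | es t w ih =>
    exact .esL (ih (struct_es_iff.1 hs) (h.map (fun n hn => by simpa using hn) id))
  | _ => exact .appR hs h

/-! ### The calculus on flat terms -/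

/-- The rules of the calculus on flat terms: `red` stands for the proper rules, `sub x v` for the
replacement of one reachable occurrence of `x` by `v`. -/
inductive Act : Type
  | red : Act
  | sub (x : ℕ) (v : Term) : Act

/-- Renaming of the free variables of a rule. -/
def Act.rename (f : ℕ → ℕ) : Act → Act
  | .red => .red
  | .sub x v => .sub (f x) (v.rename f)

/-- A rule, seen under one additional binder. -/
def Act.shift (ρ : Act) : Act := ρ.rename Nat.succ

/-- The variable that a rule replaces, if any. -/
def Act.key : Act → Option ℕ
  | .red => none
  | .sub x _ => some x

theorem Act.shift_rename (ρ : Act) (f : ℕ → ℕ) :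
    ρ.shift.rename (upRen f) = (ρ.rename f).shift := by
  cases ρ with
  | red => rfl
  | sub x v => exact congrArg (Act.sub (f x + 1)) (v.shift_rename f)

theorem Act.shift_rename_succ (ρ : Act) : ρ.shift.rename (upRen Nat.succ) = ρ.shift.shift :=
  ρ.shift_rename Nat.succ

theorem Act.rename_id (ρ : Act) : ρ.rename (fun n => n) = ρ := by
  cases ρ <;> simp [Act.rename, Term.rename_id]

/-- The variable replaced by the rule does not belong to the set. -/
def Act.Fresh (ρ : Act) (φ : Set ℕ) : Prop := ∀ x, ρ.key = some x → x ∉ φ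

theorem Act.fresh_red {φ : Set ℕ} : Act.red.Fresh φ := nofun

theorem Act.fresh_sub_zero {φ : Set ℕ} {v : Term} : (Act.sub 0 v).Fresh (keep φ) := by
  rintro x ⟨⟩; simp

theorem Act.Fresh.keep {ρ : Act} {φ : Set ℕ} (h : ρ.Fresh φ) : ρ.shift.Fresh (keep φ) := by
  cases ρ with
  | red => nofun
  | sub x v => rintro _ ⟨⟩; simpa using h x rfl

theorem Act.Fresh.bind {ρ : Act} {φ : Set ℕ} (h : ρ.Fresh φ) : ρ.shift.Fresh (bind φ) := by
  cases ρ with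
  | red => nofun
  | sub x v => rintro _ ⟨⟩; simpa using h x rfl

theorem Act.Fresh.ext {ρ : Act} {φ : Set ℕ} {u : Term} (h : ρ.Fresh φ) :
    ρ.shift.Fresh (ext φ u) := by
  cases ρ with
  | red => nofun
  | sub x v => rintro _ ⟨⟩; simpa using h x rfl

/-- Reduction of flat terms. Explicit substitutions that a step brings to the head of an
application or to the root of the content of another substitution are moved outwards at once, so
the rules `dB` and `lsv` never act at a distance. The relation is defined on all terms, and its
properties do not depend on flatness. -/
inductive CStep (c : Calculus) : Act → Set ℕ → Flag → Term → Term → Prop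
  | appL {ρ : Act} {φ : Set ℕ} {μ : Flag} {t t' u : Term} :
      CStep c ρ φ .bot t t' → CStep c ρ φ μ (.app t u) (appB t' u)
  | appR {ρ : Act} {φ : Set ℕ} {μ : Flag} {t u u' : Term} :
      Struct φ t → CStep c ρ φ .top u u' → CStep c ρ φ μ (.app t u) (.app t u')
  | lamTop {ρ : Act} {φ : Set ℕ} {t t' : Term} :
      CStep c ρ.shift (bind φ) .top t t' → CStep c ρ φ .top (.lam t) (.lam t')
  | lamBot {ρ : Act} {φ : Set ℕ} {t t' : Term} :
      CStep c ρ.shift (keep φ) .bot t t' → CStep c ρ φ .bot (.lam t) (.lam t')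
  | esL {ρ : Act} {φ : Set ℕ} {μ : Flag} {t t' u : Term} :
      CStep c ρ.shift (ext φ u) μ t t' → CStep c ρ φ μ (.es t u) (.es t' u)
  | esR {ρ : Act} {φ : Set ℕ} {μ : Flag} {t u u' : Term} :
      Reach 0 (keep φ) μ t → CStep c ρ φ .bot u u' → CStep c ρ φ μ (.es t u) (esB t u')
  | sub {φ : Set ℕ} {μ : Flag} {x : ℕ} {v : Term} : CStep c (.sub x v) φ μ (.var x) v
  | dB {φ : Set ℕ} {μ : Flag} {b u : Term} : CStep c .red φ μ (.app (.lam b) u) (esB b u)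
  | lsv {φ : Set ℕ} {μ : Flag} {t t' b : Term} :
      CStep c (.sub 0 (Term.lam b).shift) (keep φ) μ t t' →
      (c = .snPlus → LNF φ ∅ .bot (.lam b)) →
      CStep c .red φ μ (.es t (.lam b)) (.es t' (.lam b))

theorem CStep.map {c : Calculus} {ρ : Act} {f : ℕ → ℕ} {φ ψ : Set ℕ} {μ μ' : Flag}
    {t t' : Term} (h : CStep c ρ φ μ t t') (hf : MapsTo f φ ψ) (hμ : μ = .top → μ' = .top) :
    CStep c (ρ.rename f) ψ μ' (t.rename f) (t'.rename f) := by
  induction h generalizing f ψ μ' with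
  | appL _ ih => rw [appB_rename]; exact .appL (ih hf nofun)
  | appR hs _ ih => exact .appR (hs.map hf) (ih hf fun _ => rfl)
  | lamTop _ ih =>
    obtain rfl := hμ rfl
    exact .lamTop (by simpa [Act.shift_rename] using ih (mapsTo_bind hf) fun _ => rfl)
  | lamBot _ ih =>
    cases μ' with
    | top => exact .lamTop (by simpa [Act.shift_rename] using ih (mapsTo_keep_bind hf) nofun)
    | bot => exact .lamBot (by simpa [Act.shift_rename] using ih (mapsTo_keep hf) nofun)
  | esL _ ih =>
    exact .esL (by simpa [Act.shift_rename] using ih (mapsTo_ext hf fun hu => hu.map hf) hμ)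
  | esR hr _ ih => rw [esB_rename]; exact .esR (hr.map (mapsTo_keep hf) hμ) (ih hf nofun)
  | sub => exact .sub
  | dB => rw [esB_rename]; exact .dB
  | @lsv _ _ _ _ b _ hl ih =>
    refine .lsv ?_ fun hc => (hl hc).map hf (mapsTo_empty f _)
    have := ih (mapsTo_keep hf) hμ
    rwa [Act.rename, Term.shift_rename] at this

theorem CStep.mono {c : Calculus} {ρ : Act} {φ ψ : Set ℕ} {μ μ' : Flag} {t t' : Term}
    (h : CStep c ρ φ μ t t') (hf : φ ⊆ ψ) (hμ : μ = .top → μ' = .top) :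
    CStep c ρ ψ μ' t t' := by
  simpa [Term.rename_id, Act.rename_id] using h.map (f := fun n => n) (ψ := ψ) hf hμ

theorem CStep.shift {c : Calculus} {ρ : Act} {φ : Set ℕ} {μ : Flag} {t t' : Term}
    (h : CStep c ρ φ μ t t') : CStep c ρ.shift (keep φ) μ t.shift t'.shift :=
  h.map (fun n hn => by simpa using hn) id

theorem CStep.reach {c : Calculus} {x : ℕ} {v : Term} {φ : Set ℕ} {μ : Flag} {t t' : Term}
    (h : CStep c (.sub x v) φ μ t t') : Reach x φ μ t := by
  generalize hρ : Act.sub x v = ρ at h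
  induction h generalizing x v with
  | appL _ ih => exact .appL (ih hρ)
  | appR hs _ ih => exact .appR hs (ih hρ)
  | lamTop _ ih => subst hρ; exact .lamTop (ih rfl)
  | lamBot _ ih => subst hρ; exact .lamBot (ih rfl)
  | esL _ ih => subst hρ; exact .esL (ih rfl)
  | esR hr _ ih => exact .esR hr (ih hρ)
  | sub => cases hρ; exact .var
  | dB => cases hρ
  | lsv => cases hρ

theorem CStep.esB_left {c : Calculus} {ρ : Act} {φ : Set ℕ} {μ : Flag} {t t' u : Term}
    (h : CStep c ρ.shift (ext φ u) μ t t') : CStep c ρ φ μ (esB t u) (esB t' u) := by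
  induction u generalizing ρ φ t t' with
  | es u w ih =>
    exact .esL (ih (ρ.shift_rename_succ ▸ h.map mapsTo_ext_es id))
  | _ => exact .esL h

theorem CStep.esB_right {c : Calculus} {ρ : Act} {φ : Set ℕ} {μ : Flag} {t u u' : Term}
    (ht : Reach 0 (keep φ) μ t) (h : CStep c ρ φ .bot u u') :
    CStep c ρ φ μ (esB t u) (esB t u') := by
  induction u generalizing ρ φ t u' with
  | es u w ih =>
    have ht' : Reach 0 (keep (keep φ)) μ t.shiftUnder :=
      ht.map (mapsTo_keep fun n hn => by simpa using hn) id
    cases h with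
    | esL h => exact .esL (ih (ht'.mono (keep_mono keep_subset_ext) id) h)
    | esR h hw => rw [esB_assoc]; exact .esR (ht'.esB_right h) hw
    | lsv h hl => exact .lsv (ih ht' h) hl
  | _ => exact .esR ht h

theorem CStep.appB_left {c : Calculus} {ρ : Act} {φ : Set ℕ} {μ : Flag} {t t' u : Term}
    (h : CStep c ρ φ .bot t t') : CStep c ρ φ μ (appB t u) (appB t' u) := by
  induction t generalizing ρ φ t' u with
  | es t w ih =>
    cases h with
    | esL h => exact .esL (ih h)
    | esR h hw => rw [appB_esB]; exact .esR h.appB_left hw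
    | lsv h hl => exact .lsv (ih h) hl
  | _ => exact .appL h

theorem CStep.appB_right {c : Calculus} {ρ : Act} {φ : Set ℕ} {μ : Flag} {t u u' : Term}
    (hs : Struct φ t) (h : CStep c ρ φ .top u u') : CStep c ρ φ μ (appB t u) (appB t u') := by
  induction t generalizing ρ φ u u' with
  | es t w ih =>
    exact .esL (ih (struct_es_iff.1 hs) (h.map (fun n hn => by simpa using hn) id))
  | _ => exact .appR hs h

/-! ### Stability under reduction -/

theorem Act.shift_eq_sub {ρ : Act} {x : ℕ} {w : Term} (h : ρ.shift = .sub (x + 1) w) :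
    ∃ v, ρ = .sub x v ∧ w = v.shift := by
  cases ρ with
  | red => cases h
  | sub y v => cases h; exact ⟨v, rfl, rfl⟩

theorem Act.shift_ne_sub_zero {ρ : Act} {w : Term} (h : ρ.shift = .sub 0 w) : False := by
  cases ρ <;> cases h

theorem Struct.step {c : Calculus} {ρ : Act} {φ ψ : Set ℕ} {μ : Flag} {t t' : Term}
    (hs : Struct ψ t) (h : CStep c ρ φ μ t t') (hρ : ρ.Fresh ψ) : Struct ψ t' := by
  induction h generalizing ψ with
  | appL _ ih => exact struct_appB_iff.2 (ih (struct_app_iff.1 hs) hρ)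
  | appR _ _ ih => exact .app (struct_app_iff.1 hs)
  | lamTop _ ih => exact absurd hs not_struct_lam
  | lamBot _ ih => exact absurd hs not_struct_lam
  | esL _ ih => exact struct_es_iff.2 (ih (struct_es_iff.1 hs) hρ.ext)
  | esR hr _ ih =>
    exact struct_esB_iff.2 ((struct_es_iff.1 hs).mono (ext_mono' subset_rfl fun hu => ih hu hρ))
  | sub => exact absurd (struct_var_iff.1 hs) (hρ _ rfl)
  | dB => exact absurd (struct_app_iff.1 hs) not_struct_lam
  | lsv _ _ ih =>
    rw [struct_es_iff, ext_lam] at *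
    exact ih hs Act.fresh_sub_zero

/-- A reachable variable stays reachable after a step, except that its only reachable occurrence
may have been replaced by a term `v`; in that case what is reachable in `v` becomes reachable. -/
theorem Reach.step {c : Calculus} {ρ : Act} {x : ℕ} {φ ψ : Set ℕ} {μ : Flag} {t t' : Term}
    (hr : Reach x ψ μ t) (h : CStep c ρ φ μ t t') (hρ : ρ.Fresh ψ) :
    Reach x ψ μ t' ∨ ∃ v, ρ = .sub x v ∧ ∀ y, Reach y ψ .bot v → Reach y ψ μ t' := by
  induction h generalizing ψ x with
  | appL hstep ih =>
    cases hr with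
    | appL hr =>
      rcases ih hr hρ with h | ⟨v, rfl, h⟩
      · exact .inl h.appB_left
      · exact .inr ⟨v, rfl, fun y hy => (h y hy).appB_left⟩
    | appR hs hr => exact .inl (hr.appB_right (hs.step hstep hρ))
  | appR _ _ ih =>
    cases hr with
    | appL hr => exact .inl (.appL hr)
    | appR hs hr =>
      rcases ih hr hρ with h | ⟨v, rfl, h⟩
      · exact .inl (.appR hs h)
      · exact .inr ⟨v, rfl, fun y hy => .appR hs (h y hy)⟩
  | lamTop _ ih =>
    cases hr with
    | lamTop hr =>
      rcases ih hr hρ.bind with h | ⟨w, hw, h⟩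
      · exact .inl (.lamTop h)
      · obtain ⟨v, rfl, rfl⟩ := Act.shift_eq_sub hw
        exact .inr ⟨v, rfl, fun y hy => .lamTop (h _ (hy.shift.mono keep_subset_bind id))⟩
  | lamBot _ ih =>
    cases hr with
    | lamBot hr =>
      rcases ih hr hρ.keep with h | ⟨w, hw, h⟩
      · exact .inl (.lamBot h)
      · obtain ⟨v, rfl, rfl⟩ := Act.shift_eq_sub hw
        exact .inr ⟨v, rfl, fun y hy => .lamBot (h _ hy.shift)⟩
  | esL _ ih =>
    cases hr with
    | esL hr =>
      rcases ih hr hρ.ext with h | ⟨w, hw, h⟩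
      · exact .inl (.esL h)
      · obtain ⟨v, rfl, rfl⟩ := Act.shift_eq_sub hw
        exact .inr ⟨v, rfl, fun y hy => .esL (h _ (hy.shift.mono keep_subset_ext id))⟩
    | esR hr hu =>
      rcases ih hr hρ.keep with h | ⟨w, hw, h⟩
      · exact .inl (.esR h hu)
      · exact (Act.shift_ne_sub_zero hw).elim
  | esR _ hstep ih =>
    cases hr with
    | esL hr =>
      exact .inl (.esB_left (hr.mono (ext_mono' subset_rfl fun hu => hu.step hstep hρ) id))
    | esR hr hu =>
      rcases ih hu hρ with h | ⟨v, rfl, h⟩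
      · exact .inl (.esB_right hr h)
      · exact .inr ⟨v, rfl, fun y hy => .esB_right hr (h y hy)⟩
  | sub => cases hr; exact .inr ⟨_, rfl, fun y hy => hy.mono subset_rfl nofun⟩
  | dB =>
    cases hr with
    | appL hr =>
      cases hr with
      | lamBot hr => exact .inl (.esB_left (hr.mono keep_subset_ext nofun))
    | appR hs hr => exact absurd hs not_struct_lam
  | lsv _ _ ih =>
    cases hr with
    | esL hr =>
      rw [ext_lam] at hr
      rcases ih hr Act.fresh_sub_zero with h | ⟨w, hw, h⟩
      · exact .inl (.esL (by rwa [ext_lam]))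
      · cases hw
    | esR hr hu =>
      rcases ih hr Act.fresh_sub_zero with h | ⟨w, hw, h⟩
      · exact .inl (.esR h hu)
      · cases hw
        exact .inl (.esL (by rw [ext_lam]; exact h _ hu.shift))

/-- A step inside the scope of a bound variable cannot replace that variable, so it stays
reachable. -/
theorem Reach.step_zero {c : Calculus} {ρ : Act} {φ ψ : Set ℕ} {μ : Flag} {t t' : Term}
    (hr : Reach 0 (keep ψ) μ t) (h : CStep c ρ.shift φ μ t t') (hρ : ρ.Fresh ψ) :
    Reach 0 (keep ψ) μ t' := by
  rcases hr.step h hρ.keep with h | ⟨w, hw, h⟩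
  · exact h
  · exact (Act.shift_ne_sub_zero hw).elim

/-- A step of `v` can be performed on a copy of `v` at a reachable position. -/
theorem CStep.sub_step {c c' : Calculus} {ρ : Act} {x : ℕ} {v v' : Term} {φ : Set ℕ} {μ : Flag}
    {t t' : Term} (h : CStep c (.sub x v) φ μ t t') (hv : CStep c' ρ φ .bot v v') :
    ∃ s, CStep c (.sub x v') φ μ t s ∧ CStep c' ρ φ μ t' s := by
  generalize hσ : Act.sub x v = σ at h
  induction h generalizing x v v' ρ with
  | appL _ ih =>
    obtain ⟨s, h1, h2⟩ := ih hv hσ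
    exact ⟨_, .appL h1, h2.appB_left⟩
  | appR hs _ ih =>
    obtain ⟨s, h1, h2⟩ := ih hv hσ
    exact ⟨_, .appR hs h1, .appR hs h2⟩
  | lamTop _ ih =>
    subst hσ
    obtain ⟨s, h1, h2⟩ := ih (hv.shift.mono keep_subset_bind id) rfl
    exact ⟨_, .lamTop h1, .lamTop h2⟩
  | lamBot _ ih =>
    subst hσ
    obtain ⟨s, h1, h2⟩ := ih hv.shift rfl
    exact ⟨_, .lamBot h1, .lamBot h2⟩
  | esL _ ih =>
    subst hσ
    obtain ⟨s, h1, h2⟩ := ih (hv.shift.mono keep_subset_ext id) rfl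
    exact ⟨_, .esL h1, .esL h2⟩
  | esR hr _ ih =>
    obtain ⟨s, h1, h2⟩ := ih hv hσ
    exact ⟨_, .esR hr h1, h2.esB_right hr⟩
  | sub => cases hσ; exact ⟨_, .sub, hv.mono subset_rfl nofun⟩
  | dB => cases hσ
  | lsv => cases hσ

/-! ### Local normal forms do not reduce -/

theorem disjoint_ext_ext {φ ψ : Set ℕ} {u : Term} (h : Disjoint φ ψ) :
    Disjoint (ext φ u) (ext ψ u) := by
  rw [disjoint_left]
  rintro (_ | n) h1 h2
  · simp only [zero_mem_ext] at *; exact h1.not_struct_of_disjoint h h2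
  · simp only [succ_mem_ext] at *; exact disjoint_left.1 h h1 h2

theorem Struct.not_reach {x : ℕ} {φ ω : Set ℕ} {μ : Flag} {t : Term} (hs : Struct ω t)
    (hr : Reach x φ μ t) (hd : Disjoint φ ω) (hx : x ∉ ω) : False := by
  induction hr generalizing ω with
  | var => exact hx (struct_var_iff.1 hs)
  | appL _ ih => exact ih (struct_app_iff.1 hs) hd hx
  | appR hs' _ ih => exact hs'.not_struct_of_disjoint hd (struct_app_iff.1 hs)
  | lamTop _ ih => exact not_struct_lam hs
  | lamBot _ ih => exact not_struct_lam hs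
  | esL _ ih => exact ih (struct_es_iff.1 hs) (disjoint_ext_ext hd) (by simpa using hx)
  | @esR _ _ _ _ u _ _ ih ih' =>
    by_cases hu : Struct ω u
    · exact ih' hu hd hx
    · rw [struct_es_iff, ext_of_not_struct hu] at hs
      exact ih hs (disjoint_keep_keep hd) (by simp)

theorem Struct.not_step {c : Calculus} {ρ : Act} {φ ω : Set ℕ} {μ : Flag} {t t' : Term}
    (hs : Struct ω t) (h : CStep c ρ φ μ t t') (hd : Disjoint φ ω) (hρ : ρ.Fresh ω) : False := by
  induction h generalizing ω with
  | appL _ ih => exact ih (struct_app_iff.1 hs) hd hρ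
  | appR hs' _ ih => exact hs'.not_struct_of_disjoint hd (struct_app_iff.1 hs)
  | lamTop _ ih => exact not_struct_lam hs
  | lamBot _ ih => exact not_struct_lam hs
  | esL _ ih => exact ih (struct_es_iff.1 hs) (disjoint_ext_ext hd) hρ.ext
  | @esR _ _ _ _ u _ hr _ ih =>
    by_cases hu : Struct ω u
    · exact ih hu hd hρ
    · rw [struct_es_iff, ext_of_not_struct hu] at hs
      exact hs.not_reach hr (disjoint_keep_keep hd) (by simp)
  | sub => exact hρ _ rfl (struct_var_iff.1 hs)
  | dB => exact not_struct_lam (struct_app_iff.1 hs)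
  | lsv _ _ ih =>
    rw [struct_es_iff, ext_lam] at hs
    exact ih hs (disjoint_keep_keep hd) Act.fresh_sub_zero

theorem LNF.not_reach {x : ℕ} {φ ψ ω : Set ℕ} {μ : Flag} {t : Term} (hl : LNF φ ω μ t)
    (hr : Reach x ψ μ t) (hd : Disjoint ψ ω) (hφ : x ∉ φ) (hω : x ∉ ω) : False := by
  induction hl generalizing x ψ with
  | var h => cases hr; exact h.elim hφ hω
  | lamTop _ ih =>
    cases hr with
    | lamTop hr => exact ih hr (disjoint_bind_keep hd) (by simpa) (by simpa)
  | lamBot _ ih =>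
    cases hr with
    | lamBot hr => exact ih hr (disjoint_keep_bind hd) (by simpa) (by simpa)
  | es _ ih =>
    cases hr with
    | esL hr => exact ih hr (disjoint_ext_keep hd) (by simpa) (by simpa)
    | esR hr _ => exact ih hr (disjoint_keep_keep hd) (by simp) (by simp)
  | appFrozen _ _ _ ih ih' =>
    cases hr with
    | appL hr => exact ih (hr.mono subset_rfl nofun) hd hφ hω
    | appR _ hr => exact ih' hr hd hφ hω
  | appOmega _ hs ih =>
    cases hr with
    | appL hr => exact ih (hr.mono subset_rfl nofun) hd hφ hω
    | appR hs' hr => exact hs'.not_struct_of_disjoint hd hs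
  | esFrozen _ _ _ ih ih' =>
    cases hr with
    | esL hr => exact ih hr (disjoint_ext_keep hd) (by simpa) (by simpa)
    | esR _ hr => exact ih' hr hd hφ hω
  | esOmega _ hs ih =>
    cases hr with
    | esL hr =>
      rw [ext_of_not_struct (hs.not_struct_of_disjoint hd.symm)] at hr
      exact ih hr (disjoint_keep_bind hd) (by simpa) (by simpa)
    | esR _ hr => exact hs.not_reach hr hd hω

theorem LNF.not_step {c : Calculus} {ρ : Act} {φ ψ ω : Set ℕ} {μ : Flag} {t t' : Term}
    (hl : LNF φ ω μ t) (h : CStep c ρ ψ μ t t') (hd : Disjoint ψ ω) (hφ : ρ.Fresh φ)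
    (hω : ρ.Fresh ω) : False := by
  induction hl generalizing ρ ψ t' with
  | var hx => cases h; exact hx.elim (hφ _ rfl) (hω _ rfl)
  | lamTop _ ih =>
    cases h with
    | lamTop h => exact ih h (disjoint_bind_keep hd) hφ.bind hω.keep
  | lamBot _ ih =>
    cases h with
    | lamBot h => exact ih h (disjoint_keep_bind hd) hφ.keep hω.bind
  | es hl ih =>
    cases h with
    | esL h => exact ih h (disjoint_ext_keep hd) hφ.keep hω.keep
    | esR hr _ => exact hl.not_reach hr (disjoint_keep_keep hd) (by simp) (by simp)
    | lsv h _ => exact ih h (disjoint_keep_keep hd) Act.fresh_sub_zero Act.fresh_sub_zero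
  | appFrozen _ hs _ ih ih' =>
    cases h with
    | appL h => exact ih (h.mono subset_rfl nofun) hd hφ hω
    | appR _ h => exact ih' h hd hφ hω
    | dB => exact not_struct_lam hs
  | appOmega _ hs ih =>
    cases h with
    | appL h => exact ih (h.mono subset_rfl nofun) hd hφ hω
    | appR hs' h => exact hs'.not_struct_of_disjoint hd hs
    | dB => exact not_struct_lam hs
  | esFrozen _ _ hs ih ih' =>
    cases h with
    | esL h => exact ih h (disjoint_ext_keep hd) hφ.bind hω.keep
    | esR _ h => exact ih' h hd hφ hω
    | lsv => exact not_struct_lam hs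
  | esOmega _ hs ih =>
    cases h with
    | esL h =>
      rw [ext_of_not_struct (hs.not_struct_of_disjoint hd.symm)] at h
      exact ih h (disjoint_keep_bind hd) hφ.keep hω.bind
    | esR _ h => exact hs.not_step h hd hω
    | lsv => exact not_struct_lam hs

/-- A value that the restricted calculus may copy has no step of its own. -/
theorem LNF.not_step_content {c : Calculus} {ρ : Act} {φ : Set ℕ} {μ : Flag} {t t' : Term}
    (hl : LNF φ ∅ μ t) (h : CStep c ρ φ μ t t') (hρ : ρ.Fresh φ) : False :=
  hl.not_step h (disjoint_empty _) hρ fun _ _ => notMem_empty _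

/-! ### Latent steps -/

/-- Latent steps: steps of the restricted calculus inside the content of an explicit substitution
whose variable need not be reachable. They are the steps that become available if the variable
ever becomes reachable. The rule `base` performs a step of a value, and `lsv` a copy to a latent
position; the other rules follow the shape of the term. The side conditions `NotEs`, which hold in
flat terms, make a latent step that is also an actual step have the same result as the latter. -/
inductive Latent : Act → Set ℕ → Flag → Term → Term → Prop
  | base {ρ : Act} {φ : Set ℕ} {μ : Flag} {t b b' : Term} :
      CStep .snPlus ρ φ .bot (.lam b) (.lam b') →
      Latent ρ φ μ (.es t (.lam b)) (.es t (.lam b'))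
  | appL {ρ : Act} {φ : Set ℕ} {μ : Flag} {t t' u : Term} :
      t.NotEs → Latent ρ φ .bot t t' → Latent ρ φ μ (.app t u) (.app t' u)
  | appR {ρ : Act} {φ : Set ℕ} {μ : Flag} {t u u' : Term} :
      Struct φ t → Latent ρ φ .top u u' → Latent ρ φ μ (.app t u) (.app t u')
  | lamTop {ρ : Act} {φ : Set ℕ} {t t' : Term} :
      Latent ρ.shift (bind φ) .top t t' → Latent ρ φ .top (.lam t) (.lam t')
  | lamBot {ρ : Act} {φ : Set ℕ} {t t' : Term} :
      Latent ρ.shift (keep φ) .bot t t' → Latent ρ φ .bot (.lam t) (.lam t')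
  | esL {ρ : Act} {φ : Set ℕ} {μ : Flag} {t t' u : Term} :
      Latent ρ.shift (ext φ u) μ t t' → Latent ρ φ μ (.es t u) (.es t' u)
  | esR {ρ : Act} {φ : Set ℕ} {μ : Flag} {t u u' : Term} :
      u.NotEs → Latent ρ φ .bot u u' → Latent ρ φ μ (.es t u) (.es t u')
  | lsv {φ : Set ℕ} {μ : Flag} {t t' b : Term} :
      Latent (.sub 0 (Term.lam b).shift) (keep φ) μ t t' → LNF φ ∅ .bot (.lam b) →
      Latent .red φ μ (.es t (.lam b)) (.es t' (.lam b))

theorem Latent.notEs {ρ : Act} {φ : Set ℕ} {μ : Flag} {t t' : Term} (h : Latent ρ φ μ t t')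
    (ht : t.NotEs) : t'.NotEs := by
  cases h <;> first | exact ht.elim | trivial

theorem Term.NotEs.rename {t : Term} (h : t.NotEs) (f : ℕ → ℕ) : (t.rename f).NotEs := by
  cases t <;> first | exact h.elim | trivial

theorem Latent.map {ρ : Act} {f : ℕ → ℕ} {φ ψ : Set ℕ} {μ μ' : Flag}
    {t t' : Term} (h : Latent ρ φ μ t t') (hf : MapsTo f φ ψ) (hμ : μ = .top → μ' = .top) :
    Latent (ρ.rename f) ψ μ' (t.rename f) (t'.rename f) := by
  induction h generalizing f ψ μ' with
  | base h => exact .base (h.map hf nofun)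
  | appL hn _ ih => exact .appL (hn.rename f) (ih hf nofun)
  | appR hs _ ih => exact .appR (hs.map hf) (ih hf fun _ => rfl)
  | lamTop _ ih =>
    obtain rfl := hμ rfl
    exact .lamTop (by simpa [Act.shift_rename] using ih (mapsTo_bind hf) fun _ => rfl)
  | lamBot _ ih =>
    cases μ' with
    | top => exact .lamTop (by simpa [Act.shift_rename] using ih (mapsTo_keep_bind hf) nofun)
    | bot => exact .lamBot (by simpa [Act.shift_rename] using ih (mapsTo_keep hf) nofun)
  | esL _ ih =>
    exact .esL (by simpa [Act.shift_rename] using ih (mapsTo_ext hf fun hu => hu.map hf) hμ)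
  | esR hn _ ih => exact .esR (hn.rename f) (ih hf nofun)
  | @lsv _ _ _ _ b _ hl ih =>
    refine .lsv ?_ (hl.map hf (mapsTo_empty f _))
    have := ih (mapsTo_keep hf) hμ
    rwa [Act.rename, Term.shift_rename] at this

theorem Latent.mono {ρ : Act} {φ ψ : Set ℕ} {μ μ' : Flag} {t t' : Term}
    (h : Latent ρ φ μ t t') (hf : φ ⊆ ψ) (hμ : μ = .top → μ' = .top) : Latent ρ ψ μ' t t' := by
  simpa [Term.rename_id, Act.rename_id] using h.map (f := fun n => n) (ψ := ψ) hf hμ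

theorem Latent.shift {ρ : Act} {φ : Set ℕ} {μ : Flag} {t t' : Term}
    (h : Latent ρ φ μ t t') : Latent ρ.shift (keep φ) μ t.shift t'.shift :=
  h.map (fun n hn => by simpa using hn) id

theorem Latent.struct_iff {ρ : Act} {φ ψ : Set ℕ} {μ : Flag} {t t' : Term}
    (h : Latent ρ φ μ t t') : Struct ψ t' ↔ Struct ψ t := by
  induction h generalizing ψ with
  | base _ => simp [struct_es_iff, ext_lam]
  | appL _ _ ih => simp [struct_app_iff, ih]
  | appR _ _ _ => simp [struct_app_iff]
  | lamTop _ _ => simp [not_struct_lam]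
  | lamBot _ _ => simp [not_struct_lam]
  | esL _ ih => simp [struct_es_iff, ih]
  | @esR _ _ _ t u u' _ _ ih =>
    have : ext ψ u' = ext ψ u := by ext n; cases n <;> simp [ih]
    simp [struct_es_iff, this]
  | lsv _ _ ih => simp [struct_es_iff, ih]

theorem Latent.ext_eq {ρ : Act} {φ ψ : Set ℕ} {μ : Flag} {u u' : Term}
    (h : Latent ρ φ μ u u') : ext ψ u' = ext ψ u := by
  ext n; cases n <;> simp [h.struct_iff]

theorem Latent.esB_left {ρ : Act} {φ : Set ℕ} {μ : Flag} {t t' u : Term}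
    (h : Latent ρ.shift (ext φ u) μ t t') : Latent ρ φ μ (esB t u) (esB t' u) := by
  induction u generalizing ρ φ t t' with
  | es u w ih => exact .esL (ih (ρ.shift_rename_succ ▸ h.map mapsTo_ext_es id))
  | _ => exact .esL h

theorem Latent.esB_right {ρ : Act} {φ : Set ℕ} {μ : Flag} {t u u' : Term}
    (h : Latent ρ φ .bot u u') : Latent ρ φ μ (esB t u) (esB t u') := by
  induction u generalizing ρ φ t u' with
  | es u w ih =>
    cases h with
    | base h => exact .base h
    | esL h => exact .esL (ih h)
    | esR hn h => exact .esR hn h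
    | lsv h hl => exact .lsv (ih h) hl
  | _ =>
    rw [esB_of_notEs (h.notEs trivial)]
    exact .esR trivial h

theorem Latent.appB_left {ρ : Act} {φ : Set ℕ} {μ : Flag} {t t' u : Term}
    (h : Latent ρ φ .bot t t') : Latent ρ φ μ (appB t u) (appB t' u) := by
  induction t generalizing ρ φ t' u with
  | es t w ih =>
    cases h with
    | base h => exact .base h
    | esL h => exact .esL (ih h)
    | esR hn h => exact .esR hn h
    | lsv h hl => exact .lsv (ih h) hl
  | _ =>
    rw [appB_of_notEs (h.notEs trivial)]
    exact .appL trivial h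

theorem Latent.appB_right {ρ : Act} {φ : Set ℕ} {μ : Flag} {t u u' : Term}
    (hs : Struct φ t) (h : Latent ρ φ .top u u') : Latent ρ φ μ (appB t u) (appB t u') := by
  induction t generalizing ρ φ u u' with
  | es t w ih =>
    exact .esL (ih (struct_es_iff.1 hs) (h.map (fun n hn => by simpa using hn) id))
  | _ => exact .appR hs h

theorem Latent.star_lift {ρ σ : Act} {φ ψ : Set ℕ} {μ ν : Flag} {a b : Term}
    (h : ReflTransGen (Latent ρ φ μ) a b) (C : Term → Term)
    (hC : ∀ a b, Latent ρ φ μ a b → Latent σ ψ ν (C a) (C b)) :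
    ReflTransGen (Latent σ ψ ν) (C a) (C b) :=
  ReflTransGen.lift C hC a b h

/-- A latent step of `v` can be performed on a copy of `v` at a reachable position. -/
theorem Latent.sub_step {c : Calculus} {ρ : Act} {x : ℕ} {v v' : Term} {φ : Set ℕ} {μ : Flag}
    {t s' : Term} (h : CStep c (.sub x v') φ μ t s') (hv : Latent ρ φ .bot v v') :
    ∃ s, CStep c (.sub x v) φ μ t s ∧ Latent ρ φ μ s s' := by
  generalize hσ : Act.sub x v' = σ at h
  induction h generalizing x v v' ρ with
  | appL _ ih =>
    obtain ⟨s, h1, h2⟩ := ih hv hσ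
    exact ⟨_, .appL h1, h2.appB_left⟩
  | appR hs _ ih =>
    obtain ⟨s, h1, h2⟩ := ih hv hσ
    exact ⟨_, .appR hs h1, .appR hs h2⟩
  | lamTop _ ih =>
    subst hσ
    obtain ⟨s, h1, h2⟩ := ih (hv.shift.mono keep_subset_bind id) rfl
    exact ⟨_, .lamTop h1, .lamTop h2⟩
  | lamBot _ ih =>
    subst hσ
    obtain ⟨s, h1, h2⟩ := ih hv.shift rfl
    exact ⟨_, .lamBot h1, .lamBot h2⟩
  | esL _ ih =>
    subst hσ
    obtain ⟨s, h1, h2⟩ := ih (hv.shift.mono keep_subset_ext id) rfl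
    exact ⟨_, .esL h1, .esL h2⟩
  | esR hr _ ih =>
    obtain ⟨s, h1, h2⟩ := ih hv hσ
    exact ⟨_, .esR hr h1, h2.esB_right⟩
  | sub => cases hσ; exact ⟨_, .sub, hv.mono subset_rfl nofun⟩
  | dB => cases hσ
  | lsv => cases hσ

/-! ### Commutation of the two calculi -/

/-- How the two ends `t₁` and `s` of a step `ρ₁` of the restricted calculus and a step `ρ₂` of the
full calculus from the same term are joined. A full step may copy a value that the restricted step
reduces: after the copy has been reduced, the original remains to be reduced by a latent step. -/
def Joined (ρ₁ ρ₂ : Act) (φ : Set ℕ) (μ : Flag) (t₁ s : Term) : Prop :=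
  (ρ₁.key = ρ₂.key ∧ t₁ = s) ∨ ∃ t₃ s', CStep .sn ρ₂ φ μ t₁ t₃ ∧
    CStep .snPlus ρ₁ φ μ s s' ∧ ReflTransGen (Latent ρ₁ φ μ) s' t₃

/-- A context that preserves both calculi and the latent steps preserves `Joined`. -/
theorem Joined.lift {ρ₁ ρ₂ σ₁ σ₂ : Act} {φ ψ : Set ℕ} {μ ν : Flag} {t₁ s : Term}
    (h : Joined ρ₁ ρ₂ φ μ t₁ s) (C : Term → Term) (hkey : ρ₁.key = ρ₂.key → σ₁.key = σ₂.key)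
    (h₁ : ∀ a b, CStep .snPlus ρ₁ φ μ a b → CStep .snPlus σ₁ ψ ν (C a) (C b))
    (h₂ : ∀ a b, CStep .sn ρ₂ φ μ a b → CStep .sn σ₂ ψ ν (C a) (C b))
    (h₃ : ∀ a b, Latent ρ₁ φ μ a b → Latent σ₁ ψ ν (C a) (C b)) :
    Joined σ₁ σ₂ ψ ν (C t₁) (C s) := by
  rcases h with ⟨hk, rfl⟩ | ⟨t₃, s', h, h', hl⟩
  · exact .inl ⟨hkey hk, rfl⟩
  · exact .inr ⟨C t₃, C s', h₂ _ _ h, h₁ _ _ h', Latent.star_lift hl C h₃⟩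

theorem Joined.of_sn_snPlus {ρ₁ ρ₂ : Act} {φ : Set ℕ} {μ : Flag} {t₁ s r : Term}
    (h : CStep .sn ρ₂ φ μ t₁ r) (h' : CStep .snPlus ρ₁ φ μ s r) : Joined ρ₁ ρ₂ φ μ t₁ s :=
  .inr ⟨r, r, h, h', .refl⟩

theorem Act.key_of_key_shift {ρ₁ ρ₂ : Act} (h : ρ₁.shift.key = ρ₂.shift.key) :
    ρ₁.key = ρ₂.key := by
  cases ρ₁ <;> cases ρ₂ <;> simp_all [Act.shift, Act.rename, Act.key]

theorem Act.compat_shift {ρ₁ ρ₂ : Act} (h : ρ₁.key = ρ₂.key → ρ₁ = ρ₂) :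
    ρ₁.shift.key = ρ₂.shift.key → ρ₁.shift = ρ₂.shift :=
  fun hk => congrArg _ (h (Act.key_of_key_shift hk))

theorem Act.key_shift_ne_zero {ρ : Act} : ρ.shift.key ≠ some 0 := by
  cases ρ <;> simp [Act.shift, Act.rename, Act.key]

theorem CStep.joined {ρ₁ ρ₂ : Act} {φ : Set ℕ} {μ : Flag} {t t₁ s : Term}
    (h₁ : CStep .snPlus ρ₁ φ μ t t₁) (h₂ : CStep .sn ρ₂ φ μ t s)
    (hρ₁ : ρ₁.Fresh φ) (hρ₂ : ρ₂.Fresh φ) (hc : ρ₁.key = ρ₂.key → ρ₁ = ρ₂) :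
    Joined ρ₁ ρ₂ φ μ t₁ s := by
  induction h₁ generalizing ρ₂ s with
  | appL h₁ ih =>
    cases h₂ with
    | appL h₂ =>
      exact (ih h₂ hρ₁ hρ₂ hc).lift (fun t => appB t _) id (fun _ _ h => h.appB_left)
        (fun _ _ h => h.appB_left) (fun _ _ h => h.appB_left)
    | appR hs h₂ => exact .of_sn_snPlus (.appB_right (hs.step h₁ hρ₁) h₂) (.appL h₁)
    | dB =>
      cases h₁ with
      | lamBot h₁ => exact .of_sn_snPlus .dB (.esB_left (h₁.mono keep_subset_ext nofun))
  | appR hs h₁ ih =>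
    cases h₂ with
    | appL h₂ => exact .of_sn_snPlus (.appL h₂) (.appB_right (hs.step h₂ hρ₂) h₁)
    | appR hs h₂ =>
      exact (ih h₂ hρ₁ hρ₂ hc).lift (fun u => .app _ u) id (fun _ _ h => .appR hs h)
        (fun _ _ h => .appR hs h) (fun _ _ h => .appR hs h)
    | dB => exact absurd hs not_struct_lam
  | lamTop _ ih =>
    cases h₂ with
    | lamTop h₂ =>
      exact (ih h₂ hρ₁.bind hρ₂.bind (Act.compat_shift hc)).lift .lam Act.key_of_key_shift
        (fun _ _ h => .lamTop h) (fun _ _ h => .lamTop h) (fun _ _ h => .lamTop h)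
  | lamBot _ ih =>
    cases h₂ with
    | lamBot h₂ =>
      exact (ih h₂ hρ₁.keep hρ₂.keep (Act.compat_shift hc)).lift .lam Act.key_of_key_shift
        (fun _ _ h => .lamBot h) (fun _ _ h => .lamBot h) (fun _ _ h => .lamBot h)
  | esL h₁ ih =>
    cases h₂ with
    | esL h₂ =>
      exact (ih h₂ hρ₁.ext hρ₂.ext (Act.compat_shift hc)).lift (fun t => .es t _)
        Act.key_of_key_shift (fun _ _ h => .esL h) (fun _ _ h => .esL h) (fun _ _ h => .esL h)
    | esR hr h₂ =>
      refine .of_sn_snPlus (.esR (hr.step_zero h₁ hρ₁) h₂) (.esB_left (h₁.mono ?_ id))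
      exact ext_mono' subset_rfl fun hu => hu.step h₂ hρ₂
    | lsv h₂ hl =>
      rw [ext_lam] at ih
      rcases ih h₂ hρ₁.keep Act.fresh_sub_zero (fun h => (Act.key_shift_ne_zero h).elim)
        with ⟨hk, -⟩ | ⟨t₃, s', h, h', hs⟩
      · exact (Act.key_shift_ne_zero hk).elim
      · exact .inr ⟨_, _, .lsv h hl, .esL (by rwa [ext_lam]),
          Latent.star_lift hs (fun t => .es t _) fun _ _ h => .esL (by rwa [ext_lam])⟩
  | esR hr h₁ ih =>
    cases h₂ with
    | esL h₂ =>
      refine .of_sn_snPlus (.esB_left (h₂.mono ?_ id)) (.esR (hr.step_zero h₂ hρ₂) h₁)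
      exact ext_mono' subset_rfl fun hu => hu.step h₁ hρ₁
    | esR _ h₂ =>
      exact (ih h₂ hρ₁ hρ₂ hc).lift (fun u => esB _ u) id (fun _ _ h => h.esB_right hr)
        (fun _ _ h => h.esB_right hr) (fun _ _ h => h.esB_right)
    | lsv h₂ hl =>
      cases h₁ with
      | lamBot h₁ =>
        -- The full step copies a value that is not in local normal form.
        obtain ⟨r, h, h'⟩ := h₂.sub_step (CStep.lamBot h₁).shift
        exact .inr ⟨_, _, .lsv h nofun, .esL (by rwa [ext_lam]),
          .single (.base (.lamBot h₁))⟩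
  | sub => cases h₂; cases hc rfl; exact .inl ⟨rfl, rfl⟩
  | dB =>
    cases h₂ with
    | appL h₂ =>
      cases h₂ with
      | lamBot h₂ => exact .of_sn_snPlus (.esB_left (h₂.mono keep_subset_ext nofun)) .dB
    | appR hs h₂ => exact absurd hs not_struct_lam
    | dB => exact .inl ⟨rfl, rfl⟩
  | lsv h₁ hl ih =>
    cases h₂ with
    | esL h₂ =>
      rw [ext_lam] at h₂
      rcases ih h₂ Act.fresh_sub_zero hρ₂.keep (fun h => (Act.key_shift_ne_zero h.symm).elim)
        with ⟨hk, -⟩ | ⟨t₃, s', h, h', hs⟩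
      · exact (Act.key_shift_ne_zero hk.symm).elim
      · exact .inr ⟨_, _, .esL (by rwa [ext_lam]), .lsv h' hl,
          Latent.star_lift hs (fun t => .es t _) fun _ _ h => .lsv h (hl rfl)⟩
    | esR hr h₂ => exact ((hl rfl).not_step_content h₂ hρ₂).elim
    | lsv h₂ hl' =>
      exact (ih h₂ Act.fresh_sub_zero Act.fresh_sub_zero fun _ => rfl).lift (fun t => .es t _)
        (fun _ => rfl) (fun _ _ h => .lsv h hl) (fun _ _ h => .lsv h hl')
        (fun _ _ h => .lsv h (hl rfl))

/-! ### Latent steps and reduction -/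

/-- Freezing more variables makes a new structure only if one of them is reachable. -/
theorem Struct.freeze {φ ψ : Set ℕ} {t : Term} (h : Struct ψ t) (hs : φ ⊆ ψ) (μ : Flag) :
    Struct φ t ∨ ∃ x ∈ ψ, x ∉ φ ∧ Reach x φ μ t := by
  induction t generalizing φ ψ μ with
  | var x =>
    by_cases hx : x ∈ φ
    · exact .inl (.var hx)
    · exact .inr ⟨x, struct_var_iff.1 h, hx, .var⟩
  | lam t => exact absurd h not_struct_lam
  | app t u ih =>
    rcases ih (struct_app_iff.1 h) hs .bot with h | ⟨x, h1, h2, h3⟩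
    · exact .inl (.app h)
    · exact .inr ⟨x, h1, h2, .appL h3⟩
  | es t u ih ihu =>
    rcases ih (struct_es_iff.1 h) (ext_mono hs) μ with h | ⟨_ | x, h1, h2, h3⟩
    · exact .inl (struct_es_iff.2 h)
    · simp only [zero_mem_ext] at h1 h2
      rw [ext_of_not_struct h2] at h3
      obtain ⟨y, hy1, hy2, hy3⟩ := (ihu h1 hs .bot).resolve_left h2
      exact .inr ⟨y, hy1, hy2, .esR h3 hy3⟩
    · simp only [succ_mem_ext] at h1 h2
      exact .inr ⟨x, h1, h2, .esL h3⟩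

theorem Reach.flag_of_struct {x : ℕ} {φ ψ : Set ℕ} {μ μ' : Flag} {t : Term} (h : Reach x φ μ t)
    (hs : Struct ψ t) : Reach x φ μ' t := by
  induction h generalizing ψ with
  | var => exact .var
  | appL h _ => exact .appL h
  | appR hst h _ => exact .appR hst h
  | lamTop _ _ => exact absurd hs not_struct_lam
  | lamBot _ _ => exact absurd hs not_struct_lam
  | esL _ ih => exact .esL (ih (struct_es_iff.1 hs))
  | esR _ hu ih _ => exact .esR (ih (struct_es_iff.1 hs)) hu

/-- Freezing more variables makes a new local normal form only if one of them is reachable. -/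
theorem LNF.freeze {φ ψ ω : Set ℕ} {μ : Flag} {t : Term} (h : LNF ψ ω μ t) (hs : φ ⊆ ψ) :
    LNF φ ω μ t ∨ ∃ x ∈ ψ, x ∉ φ ∧ Reach x φ μ t := by
  induction h generalizing φ with
  | @var _ _ _ x h =>
    by_cases hx : x ∈ φ
    · exact .inl (.var (.inl hx))
    · rcases h with h | h
      · exact .inr ⟨x, h, hx, .var⟩
      · exact .inl (.var (.inr h))
  | lamTop _ ih =>
    rcases ih (bind_mono hs) with h | ⟨_ | x, h1, h2, h3⟩
    · exact .inl (.lamTop h)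
    · simp at h2
    · exact .inr ⟨x, by simpa using h1, by simpa using h2, .lamTop h3⟩
  | lamBot _ ih =>
    rcases ih (keep_mono hs) with h | ⟨_ | x, h1, h2, h3⟩
    · exact .inl (.lamBot h)
    · simp at h1
    · exact .inr ⟨x, by simpa using h1, by simpa using h2, .lamBot h3⟩
  | es _ ih =>
    rcases ih (keep_mono hs) with h | ⟨_ | x, h1, h2, h3⟩
    · exact .inl (.es h)
    · simp at h1
    · exact .inr ⟨x, by simpa using h1, by simpa using h2, .esL (h3.mono keep_subset_ext id)⟩
  | appFrozen _ hst _ ih ih' =>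
    rcases ih hs with h | ⟨x, h1, h2, h3⟩
    · rcases hst.freeze hs .bot with hst | ⟨x, h1, h2, h3⟩
      · rcases ih' hs with h' | ⟨x, h1, h2, h3⟩
        · exact .inl (.appFrozen h hst h')
        · exact .inr ⟨x, h1, h2, .appR hst h3⟩
      · exact .inr ⟨x, h1, h2, .appL h3⟩
    · exact .inr ⟨x, h1, h2, .appL (h3.flag_of_struct hst)⟩
  | appOmega _ hst ih =>
    rcases ih hs with h | ⟨x, h1, h2, h3⟩
    · exact .inl (.appOmega h hst)
    · exact .inr ⟨x, h1, h2, .appL (h3.flag_of_struct hst)⟩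
  | @esFrozen ψ ω μ t u _ _ hst ih ih' =>
    by_cases hu : Struct φ u ∧ LNF φ ω .bot u
    · rcases ih (bind_mono hs) with h | ⟨_ | x, h1, h2, h3⟩
      · exact .inl (.esFrozen h hu.2 hu.1)
      · simp at h2
      · exact .inr ⟨x, by simpa using h1, by simpa using h2,
          .esL (h3.mono (bind_subset_ext hu.1) id)⟩
    · have hr : ∃ y ∈ ψ, y ∉ φ ∧ Reach y φ .bot u := by
        rcases hst.freeze hs .bot with h | h
        · exact (ih' hs).resolve_left fun h' => hu ⟨h, h'⟩
        · exact h
      rcases ih ((keep_mono hs).trans keep_subset_bind) with h | ⟨_ | x, h1, h2, h3⟩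
      · exact .inl (.es h)
      · obtain ⟨y, hy1, hy2, hy3⟩ := hr
        exact .inr ⟨y, hy1, hy2, .esR h3 hy3⟩
      · exact .inr ⟨x, by simpa using h1, by simpa using h2, .esL (h3.mono keep_subset_ext id)⟩
  | esOmega _ hst ih =>
    rcases ih (keep_mono hs) with h | ⟨_ | x, h1, h2, h3⟩
    · exact .inl (.esOmega h hst)
    · simp at h1
    · exact .inr ⟨x, by simpa using h1, by simpa using h2, .esL (h3.mono keep_subset_ext id)⟩

theorem CStep.appL_of_notEs {c : Calculus} {ρ : Act} {φ : Set ℕ} {μ : Flag} {t t' u : Term}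
    (h : CStep c ρ φ .bot t t') (ht : t'.NotEs) : CStep c ρ φ μ (.app t u) (.app t' u) :=
  appB_of_notEs ht ▸ .appL h

theorem CStep.esR_of_notEs {c : Calculus} {ρ : Act} {φ : Set ℕ} {μ : Flag} {t u u' : Term}
    (hr : Reach 0 (keep φ) μ t) (h : CStep c ρ φ .bot u u') (hu : u'.NotEs) :
    CStep c ρ φ μ (.es t u) (.es t u') :=
  esB_of_notEs hu ▸ .esR hr h

/-- A latent step that is not an actual step does not create a local normal form. -/
theorem Latent.lnf {ρ : Act} {φ ψ ω : Set ℕ} {μ : Flag} {a b : Term} (h : Latent ρ φ μ a b)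
    (hs : ψ ⊆ φ) (hb : LNF ψ ω μ b) : CStep .snPlus ρ φ μ a b ∨ LNF ψ ω μ a := by
  induction h generalizing ψ ω with
  | base h =>
    cases hb with
    | es hb => exact .inr (.es hb)
    | esFrozen _ _ hst => exact absurd hst not_struct_lam
    | esOmega _ hst => exact absurd hst not_struct_lam
  | appL hn h ih =>
    cases hb with
    | appFrozen hb hst hu =>
      refine (ih hs (hb.flag_of_struct hst)).imp (·.appL_of_notEs (h.notEs hn)) fun h' => ?_
      rw [h.struct_iff] at hst
      exact .appFrozen (h'.flag_of_struct hst) hst hu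
    | appOmega hb hst =>
      refine (ih hs (hb.flag_of_struct hst)).imp (·.appL_of_notEs (h.notEs hn)) fun h' => ?_
      rw [h.struct_iff] at hst
      exact .appOmega (h'.flag_of_struct hst) hst
  | appR hst h ih =>
    cases hb with
    | appFrozen hb hst' hu => exact (ih hs hu).imp (.appR hst) (.appFrozen hb hst')
    | appOmega hb hst' => exact .inr (.appOmega hb hst')
  | lamTop h ih =>
    cases hb with
    | lamTop hb => exact (ih (bind_mono hs) hb).imp .lamTop .lamTop
  | lamBot h ih =>
    cases hb with
    | lamBot hb => exact (ih (keep_mono hs) hb).imp .lamBot .lamBot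
  | esL h ih =>
    cases hb with
    | es hb => exact (ih ((keep_mono hs).trans keep_subset_ext) hb).imp .esL .es
    | esFrozen hb hu hst =>
      exact (ih ((bind_mono hs).trans (bind_subset_ext (hst.mono hs))) hb).imp .esL
        (.esFrozen · hu hst)
    | esOmega hb hst =>
      exact (ih ((keep_mono hs).trans keep_subset_ext) hb).imp .esL (.esOmega · hst)
  | esR hn h ih =>
    cases hb with
    | es hb => exact .inr (.es hb)
    | esFrozen hb hu hst =>
      rcases ih hs hu with h' | h'
      · rcases hb.freeze keep_subset_bind with hb | ⟨_ | x, h1, h2, h3⟩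
        · exact .inr (.es hb)
        · exact .inl (.esR_of_notEs (h3.mono (keep_mono hs) id) h' (h.notEs hn))
        · simp only [succ_mem_bind, succ_mem_keep] at h1 h2; exact absurd h1 h2
      · exact .inr (.esFrozen hb h' (h.struct_iff.1 hst))
    | esOmega hb hst => exact .inr (.esOmega hb (h.struct_iff.1 hst))
  | lsv h hl ih =>
    cases hb with
    | es hb => exact (ih (keep_mono hs) hb).imp (.lsv · fun _ => hl) .es
    | esFrozen _ _ hst => exact absurd hst not_struct_lam
    | esOmega _ hst => exact absurd hst not_struct_lam

/-- A latent step that is not an actual step does not make a variable reachable. -/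
theorem Latent.reach {ρ : Act} {x : ℕ} {φ ψ : Set ℕ} {μ : Flag} {a b : Term}
    (h : Latent ρ φ μ a b) (hs : ψ ⊆ φ) (hr : Reach x ψ μ b) :
    CStep .snPlus ρ φ μ a b ∨ Reach x ψ μ a := by
  induction h generalizing ψ x with
  | base h =>
    cases hr with
    | esL hr => exact .inr (.esL (by rwa [ext_lam] at *))
    | esR hr _ => exact .inl (.esR (hr.mono (keep_mono hs) id) h)
  | appL hn h ih =>
    cases hr with
    | appL hr => exact (ih hs hr).imp (·.appL_of_notEs (h.notEs hn)) .appL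
    | appR hst hr => exact .inr (.appR (h.struct_iff.1 hst) hr)
  | appR hst h ih =>
    cases hr with
    | appL hr => exact .inr (.appL hr)
    | appR hst' hr => exact (ih hs hr).imp (.appR hst) (.appR hst')
  | lamTop h ih =>
    cases hr with
    | lamTop hr => exact (ih (bind_mono hs) hr).imp .lamTop .lamTop
  | lamBot h ih =>
    cases hr with
    | lamBot hr => exact (ih (keep_mono hs) hr).imp .lamBot .lamBot
  | esL h ih =>
    cases hr with
    | esL hr => exact (ih (ext_mono hs) hr).imp .esL .esL
    | esR hr hu => exact (ih ((keep_mono hs).trans keep_subset_ext) hr).imp .esL (.esR · hu)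
  | esR hn h ih =>
    cases hr with
    | esL hr => exact .inr (.esL (by rwa [h.ext_eq] at hr))
    | esR hr hu =>
      exact (ih hs hu).imp (.esR_of_notEs (hr.mono (keep_mono hs) id) · (h.notEs hn)) (.esR hr)
  | lsv h hl ih =>
    cases hr with
    | esL hr =>
      rw [ext_lam] at hr
      exact (ih (keep_mono hs) hr).imp (.lsv · fun _ => hl) fun hr => .esL (by rwa [ext_lam])
    | esR hr hu => exact (ih (keep_mono hs) hr).imp (.lsv · fun _ => hl) (.esR · hu)

/-- A latent step that is not an actual step can be postponed after the next step. -/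
theorem Latent.postpone {ρ σ : Act} {φ : Set ℕ} {μ : Flag} {a b b' : Term}
    (h : Latent ρ φ μ a b) (hb : CStep .snPlus σ φ μ b b') (hσ : σ.Fresh φ) :
    CStep .snPlus ρ φ μ a b ∨
      ∃ a', CStep .snPlus σ φ μ a a' ∧ ReflTransGen (Latent ρ φ μ) a' b' := by
  induction h generalizing σ b' with
  | base h =>
    cases hb with
    | esL hb =>
      rw [ext_lam] at hb
      exact .inr ⟨_, .esL (by rwa [ext_lam]), .single (.base h)⟩
    | esR hr _ => exact .inl (.esR hr h)
    | lsv hb _ => exact .inl (.esR hb.reach h)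
  | appL hn h ih =>
    cases hb with
    | appL hb =>
      refine (ih hb hσ).imp (·.appL_of_notEs (h.notEs hn)) ?_
      rintro ⟨a', h1, h2⟩
      exact ⟨_, .appL h1, star_lift h2 (fun t => appB t _) fun _ _ h => h.appB_left⟩
    | appR hst hb => exact .inr ⟨_, .appR (h.struct_iff.1 hst) hb, .single (.appL hn h)⟩
    | dB =>
      cases h with
      | lamBot h => exact .inr ⟨_, .dB, .single (.esB_left (h.mono keep_subset_ext nofun))⟩
  | appR hst h ih =>
    cases hb with
    | appL hb => exact .inr ⟨_, .appL hb, .single (.appB_right (hst.step hb hσ) h)⟩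
    | appR hst' hb =>
      refine (ih hb hσ).imp (.appR hst) ?_
      rintro ⟨a', h1, h2⟩
      exact ⟨_, .appR hst h1, star_lift h2 (fun t => .app _ t) fun _ _ h => .appR hst h⟩
    | dB => exact absurd hst not_struct_lam
  | lamTop h ih =>
    cases hb with
    | lamTop hb =>
      refine (ih hb hσ.bind).imp .lamTop ?_
      rintro ⟨a', h1, h2⟩
      exact ⟨_, .lamTop h1, star_lift h2 .lam fun _ _ h => .lamTop h⟩
  | lamBot h ih =>
    cases hb with
    | lamBot hb =>
      refine (ih hb hσ.keep).imp .lamBot ?_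
      rintro ⟨a', h1, h2⟩
      exact ⟨_, .lamBot h1, star_lift h2 .lam fun _ _ h => .lamBot h⟩
  | esL h ih =>
    cases hb with
    | esL hb =>
      refine (ih hb hσ.ext).imp .esL ?_
      rintro ⟨a', h1, h2⟩
      exact ⟨_, .esL h1, star_lift h2 (fun t => .es t _) fun _ _ h => .esL h⟩
    | esR hr hb =>
      refine (h.reach keep_subset_ext hr).imp .esL fun hr => ⟨_, .esR hr hb, .single ?_⟩
      exact .esB_left (h.mono (ext_mono' subset_rfl fun hu => hu.step hb hσ) id)
    | lsv hb hl =>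
      rw [ext_lam] at ih
      refine (ih hb Act.fresh_sub_zero).imp (fun h => .esL (by rwa [ext_lam])) ?_
      rintro ⟨a', h1, h2⟩
      exact ⟨_, .lsv h1 hl,
        star_lift h2 (fun t => .es t _) fun _ _ h => .esL (by rwa [ext_lam])⟩
  | esR hn h ih =>
    cases hb with
    | esL hb => exact .inr ⟨_, .esL (by rwa [h.ext_eq] at hb), .single (.esR hn h)⟩
    | esR hr hb =>
      refine (ih hb hσ).imp (.esR_of_notEs hr · (h.notEs hn)) ?_
      rintro ⟨a', h1, h2⟩
      exact ⟨_, .esR hr h1, star_lift h2 (fun t => esB _ t) fun _ _ h => h.esB_right⟩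
    | lsv hb hl =>
      cases h with
      | lamBot h =>
        rcases (Latent.lamBot h).lnf subset_rfl (hl rfl) with h' | h'
        · exact .inl (.esR hb.reach h')
        · -- Copying the value before its latent step leaves two latent steps, one in each copy.
          obtain ⟨s, h1, h2⟩ := Latent.sub_step hb (Latent.lamBot h).shift
          refine .inr ⟨_, .lsv h1 fun _ => h', .trans (.single (.esL ?_)) (.single (.esR hn ?_))⟩
          · rwa [ext_lam]
          · exact .lamBot h
  | lsv h hl ih =>
    cases hb with
    | esL hb =>
      rw [ext_lam] at hb
      refine (ih hb hσ.keep).imp (.lsv · fun _ => hl) ?_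
      rintro ⟨a', h1, h2⟩
      exact ⟨_, .esL (by rwa [ext_lam]), star_lift h2 (fun t => .es t _) fun _ _ h => .lsv h hl⟩
    | esR _ hb => exact (hl.not_step_content hb hσ).elim
    | lsv hb hl' =>
      refine (ih hb Act.fresh_sub_zero).imp (.lsv · fun _ => hl) ?_
      rintro ⟨a', h1, h2⟩
      exact ⟨_, .lsv h1 hl', star_lift h2 (fun t => .es t _) fun _ _ h => .lsv h hl⟩

/-! ### Flattening preserves reduction -/

/-- What a step by the rule `ρ` becomes between the flat forms `a` and `b`. -/
def FlatStep (c : Calculus) (φ : Set ℕ) (μ : Flag) (a b : Term) : Rule → Prop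
  | .dB => CStep c .red φ μ a b
  | .lsv => CStep c .red φ μ a b
  | .idx x => Reach x φ μ a
  | .sub x v => CStep c (.sub x v.flat) φ μ a b

section FlatStep
variable {c : Calculus} {ρ : Rule} {φ ψ : Set ℕ} {μ ν : Flag}

/-- Two contexts, one for each side of a step, that preserve reachability and the steps of the flat
calculus preserve `FlatStep`. -/
theorem FlatStep.lift {a a' : Term} (C : Term → Term) (h : FlatStep c φ μ a a' ρ)
    (h₁ : ∀ x, Reach x φ μ a → Reach x ψ ν (C a))
    (h₂ : ∀ ρ, CStep c ρ φ μ a a' → CStep c ρ ψ ν (C a) (C a')) :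
    FlatStep c ψ ν (C a) (C a') ρ := by
  cases ρ with
  | idx x => exact h₁ x h
  | _ => exact h₂ _ h

theorem FlatStep.lift_shift {a a' : Term} (C : Term → Term) (h : FlatStep c φ μ a a' ρ.shift)
    (h₁ : ∀ x, Reach (x + 1) φ μ a → Reach x ψ ν (C a))
    (h₂ : ∀ ρ : Act, CStep c ρ.shift φ μ a a' → CStep c ρ ψ ν (C a) (C a')) :
    FlatStep c ψ ν (C a) (C a') ρ := by
  cases ρ with
  | dB => exact h₂ .red h
  | lsv => exact h₂ .red h
  | idx x => exact h₁ x h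
  | sub x v =>
    refine h₂ (.sub x v.flat) ?_
    rw [Rule.shift, FlatStep, Term.shift, Term.flat_rename] at h
    exact h

end FlatStep

theorem AuxDB.flat {c : Calculus} {t t' : Term} (h : AuxDB t t') (φ : Set ℕ) (μ : Flag) :
    CStep c .red φ μ t.flat t'.flat := by
  induction h generalizing φ with
  | base => exact .dB
  | @sigma t u w s _ ih =>
    have := ih (ext φ w.flat)
    simp only [Term.flat, appB_esB]
    rw [Term.flat, Term.shift, Term.flat_rename] at this
    exact .esB_left this

mutual

theorem Step.flat {c : Calculus} {ρ : Rule} {φ : Set ℕ} {μ : Flag} {t t' : Term} :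
    Step c ρ φ μ t t' → FlatStep c φ μ t.flat t'.flat ρ
  | .appLeft h =>
    h.flat.lift (fun t => appB t _) (fun _ h => h.appB_left) (fun _ h => h.appB_left)
  | .appRight hs h =>
    h.flat.lift (fun u => appB _ u) (fun _ h => h.appB_right hs.flat)
      (fun _ h => h.appB_right hs.flat)
  | .lamTop h => h.flat.lift_shift .lam (fun _ h => .lamTop h) (fun _ h => .lamTop h)
  | .lamBot h => h.flat.lift_shift .lam (fun _ h => .lamBot h) (fun _ h => .lamBot h)
  | .esLeft h =>
    h.flat.lift_shift (fun t => esB t _) (fun _ h => (h.mono keep_subset_ext id).esB_left)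
      (fun _ h => (h.mono keep_subset_ext id).esB_left)
  | .esLeftStruct h hs =>
    h.flat.lift_shift (fun t => esB t _)
      (fun _ h => (h.mono (bind_subset_ext hs.flat) id).esB_left)
      (fun _ h => (h.mono (bind_subset_ext hs.flat) id).esB_left)
  | .esRight hr h =>
    h.flat.lift (fun u => esB _ u) (fun _ h => .esB_right hr.flat h)
      (fun _ h => h.esB_right hr.flat)
  | .idx => Reach.var
  | .sub => CStep.sub
  | .dB h => h.flat _ _
  | .lsv h => h.flat

theorem AuxLSV.flat {c : Calculus} {φ : Set ℕ} {μ : Flag} {t t' : Term} :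
    AuxLSV c φ μ t t' → CStep c .red φ μ t.flat t'.flat
  | .base h hv hl => by
    obtain ⟨b, rfl⟩ := hv
    have h := h.flat
    rw [FlatStep, Term.shift, Term.flat_rename] at h
    exact .lsv h fun hc => (hl hc).flat (disjoint_empty _)
  | .sigma h => by
    have h := h.flat
    rw [Term.flat, Term.shiftUnder, Term.flat_rename] at h
    rw [Term.flat, Term.flat, esB_assoc]
    exact .esB_left (h.mono keep_subset_ext id)
  | .sigmaStruct h hs => by
    have h := h.flat
    rw [Term.flat, Term.shiftUnder, Term.flat_rename] at h
    rw [Term.flat, Term.flat, esB_assoc]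
    exact .esB_left (h.mono (bind_subset_ext hs.flat) id)

end

theorem Red.flat {c : Calculus} {φ : Set ℕ} {μ : Flag} {t t' : Term} (h : Red c φ μ t t') :
    CStep c .red φ μ t.flat t'.flat :=
  h.elim (·.flat) (·.flat)

mutual

theorem Step.sn {c : Calculus} {ρ : Rule} {φ : Set ℕ} {μ : Flag} {t t' : Term} :
    Step c ρ φ μ t t' → Step .sn ρ φ μ t t'
  | .appLeft h => .appLeft h.sn
  | .appRight hs h => .appRight hs h.sn
  | .lamTop h => .lamTop h.sn
  | .lamBot h => .lamBot h.sn
  | .esLeft h => .esLeft h.sn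
  | .esLeftStruct h hs => .esLeftStruct h.sn hs
  | .esRight hr h => .esRight hr.sn h.sn
  | .idx => .idx
  | .sub => .sub
  | .dB h => .dB h
  | .lsv h => .lsv h.sn

theorem AuxLSV.sn {c : Calculus} {φ : Set ℕ} {μ : Flag} {t t' : Term} :
    AuxLSV c φ μ t t' → AuxLSV .sn φ μ t t'
  | .base h hv _ => .base h.sn hv nofun
  | .sigma h => .sigma h.sn
  | .sigmaStruct h hs => .sigmaStruct h.sn hs

end

theorem RedSeq.sn {c : Calculus} {φ : Set ℕ} {μ : Flag} {n : ℕ} {t t' : Term}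
    (h : RedSeq c φ μ n t t') : RedSeq .sn φ μ n t t' := by
  induction h with
  | refl => exact .refl
  | step h _ ih => exact .step (h.imp (·.sn) (·.sn)) ih

/-! ### Lengths of reduction sequences -/

/-- Some sequence of `k` restricted steps starts from the term. -/
inductive HasSeq (φ : Set ℕ) (μ : Flag) : ℕ → Term → Prop
  | zero {t : Term} : HasSeq φ μ 0 t
  | succ {k : ℕ} {t s : Term} :
      CStep .snPlus .red φ μ t s → HasSeq φ μ k s → HasSeq φ μ (k + 1) t

theorem HasSeq.of_succ {φ : Set ℕ} {μ : Flag} {k : ℕ} {t : Term} (h : HasSeq φ μ (k + 1) t) :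
    HasSeq φ μ k t := by
  induction k generalizing t with
  | zero => exact .zero
  | succ k ih =>
    cases h with
    | succ h h' => exact .succ h (ih h')

/-- Latent steps do not make longer sequences of restricted steps possible. Only prefixes of
sequences are compared, so that it does not matter how many latent steps a step multiplies. -/
theorem HasSeq.of_latent {φ : Set ℕ} {μ : Flag} {k : ℕ} {a b : Term} (h : HasSeq φ μ k b)
    (hl : ReflTransGen (Latent .red φ μ) a b) : HasSeq φ μ k a := by
  induction k generalizing a b with
  | zero => exact .zero
  | succ k ih =>
    induction hl using ReflTransGen.head_induction_on with
    | refl => exact h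
    | head hl _ h =>
      cases id h with
      | succ hb h' =>
        rcases hl.postpone hb Act.fresh_red with hl | ⟨a', ha, hl⟩
        · exact .succ hl h.of_succ
        · exact .succ ha (ih h' hl)

/-- A step of the full calculus shortens the sequences of restricted steps by at most one. -/
theorem HasSeq.sn_step {φ : Set ℕ} {μ : Flag} {k : ℕ} {t s : Term} (h : HasSeq φ μ (k + 1) t)
    (hs : CStep .sn .red φ μ t s) : HasSeq φ μ k s := by
  induction k generalizing t s with
  | zero => exact .zero
  | succ k ih =>
    cases h with
    | succ ht h =>
      rcases ht.joined hs Act.fresh_red Act.fresh_red fun _ => rfl with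
        ⟨-, rfl⟩ | ⟨t₃, s', h1, h2, h3⟩
      · exact h
      · exact .succ h2 ((ih h h1).of_latent h3)

theorem RedSeq.hasSeq {φ : Set ℕ} {μ : Flag} {m : ℕ} {t t' : Term}
    (h : RedSeq .snPlus φ μ m t t') : HasSeq φ μ m t.flat := by
  induction h with
  | refl => exact .zero
  | step h _ ih => exact .succ h.flat ih

theorem NF.not_cstep {c : Calculus} {φ : Set ℕ} {μ : Flag} {t s : Term} (h : NF φ t) :
    ¬ CStep c .red φ μ t.flat s := fun hs =>
  (h.lnf.flat (disjoint_empty _)).not_step_content (hs.mono subset_rfl fun _ => rfl)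
    Act.fresh_red

theorem HasSeq.le_of_redSeq {φ : Set ℕ} {μ : Flag} {m n : ℕ} {t t' : Term} (hnf : NF φ t')
    (h : HasSeq φ μ m t.flat) (hn : RedSeq .sn φ μ n t t') : m ≤ n := by
  induction hn generalizing m with
  | refl =>
    cases h with
    | zero => exact le_rfl
    | succ h _ => exact absurd h hnf.not_cstep
  | step hs _ ih =>
    cases m with
    | zero => exact Nat.zero_le _
    | succ m => exact Nat.succ_le_succ (ih hnf (h.sn_step hs.flat))

end StrongCBN

theorem mainTheorem3 (φ : Set ℕ) (μ : StrongCBN.Flag) (t t' : StrongCBN.Term) (m : ℕ)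
    (hnf : StrongCBN.NF φ t')
    (hm : StrongCBN.RedSeq .snPlus φ μ m t t') :
    (∀ n : ℕ, StrongCBN.RedSeq .sn φ μ n t t' → m ≤ n) ∧
      StrongCBN.RedSeq .sn φ μ m t t' :=
  ⟨fun _ hn => hm.hasSeq.le_of_redSeq hnf hn, hm.sn⟩
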